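/- Let $M$ be a smooth $n$-dimensional manifold (Hausdorff, second countable, without boundary). A (smooth) half-density on $M$ is given in local coordinates by $\mathbf s=s(x)\sqrt{|Dx|}$, with $s(x)=s'(x'(x))\sqrt{|J|}$ under a change of coordinates $x\mapsto x'$, where $J=\det(\partial x'/\partial x)$. Consider differential operators $\Delta$ of order at most two, with smooth real coefficients, acting on the half-densities on $M$. Such an operator has principal symbol $S$, a contravariant symmetric rank $2$ tensor field $S=S^{ab}\partial_b\otimes\partial_a$, if $\Delta=\frac12 S^{ab}\partial_b\partial_a+(\text{terms of order}\le 1)$ in all local coordinates, and it is self-adjoint if $\langle\Delta\mathbf s_1,\mathbf s_2\rangle=\langle\mathbf s_1,\Delta\mathbf s_2\rangle$ for all half-densities $\mathbf s_1,\mathbf s_2$ with compact support, where $\langle\mathbf s_1,\mathbf s_2\rangle=\int_M s_1(x)s_2(x)\,|Dx|$. A compensating field for $S$ is a family $U$ of smooth functions $U(x)$, one for each local coordinate system, such that under every change of coordinates $x\mapsto x'$ $$U'(x')=U(x)+\tfrac12\,\partial_{a'}\bigl(S^{a'b'}\partial_{b'}\log|J|\bigr)-\tfrac14\,\partial_{a'}\log|J|\;S^{a'b'}\,\partial_{b'}\log|J|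 .$$ Then self-adjoint operators $\Delta$ of order at most two on half-densities correspond one-to-one to pairs $(S,U)$ of a contravariant symmetric rank $2$ tensor field $S$ on $M$ and a compensating field $U$ for $S$: 1. every such $\Delta$ has exactly one principal symbol $S$, and there is exactly one family $U$ of smooth functions, one for each local coordinate system, such that in all local coordinates $$\Delta=\tfrac12\bigl(S^{ab}\partial_b\partial_a+(\partial_bS^{ba})\,\partial_a+U\bigr);$$ this family $U$ is a compensating field for $S$; 2. conversely, for every $S$ and every compensating field $U$ for $S$ there is exactly one linear operator $\Delta$ on half-densities that is given by this formula in all local coordinates, and it is a self-adjoint differential operator of order at most two with principal symbol $S$. For every fixed $S$, the set of compensating fields for $S$ is a (nonempty) affine space associated with the vector space $C^\infty(M)$ of smooth functions on $M$, where a function $F$ acts by $U\mapsto U+F$ in all local coordinates. -/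

import Mathlib

open scoped Manifold ContDiff
open MeasureTheory

namespace HalfDensities

/-- The model space `ℝⁿ`. -/
abbrev Coord (n : ℕ) : Type := EuclideanSpace ℝ (Fin n)

section

variable (n : ℕ) (M : Type*) [TopologicalSpace M] [ChartedSpace (Coord n) M]

/-- Local coordinate systems on the smooth manifold `M`: all charts of the maximal smooth atlas. -/
abbrev Chart : Type _ :=
  {φ : OpenPartialHomeomorph M (Coord n) // φ ∈ IsManifold.maximalAtlas 𝓘(ℝ, Coord n) ∞ M}

end

section

variable {n : ℕ} {M : Type*} [TopologicalSpace M] [ChartedSpace (Coord n) M]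

/-- The partial derivative `∂f/∂x^a`. -/
noncomputable def pd (a : Fin n) (f : Coord n → ℝ) (x : Coord n) : ℝ :=
  fderiv ℝ f x (EuclideanSpace.single a 1)

/-- The domain, in the coordinates `φ`, of the change of coordinates from `φ` to `ψ`. -/
def overlap (φ ψ : Chart n M) : Set (Coord n) :=
  (φ.1.symm.trans ψ.1).source

/-- The change of coordinates `x ↦ x'`, where `x` are the coordinates `φ` and `x'` are the
coordinates `ψ`. -/
noncomputable def transition (φ ψ : Chart n M) (x : Coord n) : Coord n :=
  ψ.1 (φ.1.symm x)

/-- The entry `∂x^{a'}/∂x^a` of the Jacobi matrix of the change of coordinates from `φ` to `ψ`. -/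
noncomputable def jacobiEntry (φ ψ : Chart n M) (x : Coord n) (a' a : Fin n) : ℝ :=
  fderiv ℝ (transition φ ψ) x (EuclideanSpace.single a 1) a'

/-- The Jacobian `J = det (∂x'/∂x)` at the point with coordinates `x`. -/
noncomputable def jacobian (φ ψ : Chart n M) (x : Coord n) : ℝ :=
  (fderiv ℝ (transition φ ψ) x).det

/-- `log |J|`, `J = det (∂x'/∂x)`, as a function of the new coordinates `x'`. -/
noncomputable def logJ (φ ψ : Chart n M) (x' : Coord n) : ℝ :=
  Real.log |jacobian φ ψ (transition ψ φ x')|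

/-- Smooth functions on the domain of a chart, in coordinates. They are extended by zero to the
rest of `ℝⁿ`, so that equality of functions is equality on the domain of the chart. -/
def IsLocalFunction (φ : Chart n M) (f : Coord n → ℝ) : Prop :=
  ContDiffOn ℝ ∞ f φ.1.target ∧ ∀ x, x ∉ φ.1.target → f x = 0

variable (n M) in
/-- Smooth half-densities `s(x) √|Dx|` on `M`: a smooth coefficient `s` in every coordinate system,
with `s(x) = s'(x'(x)) √|J|` under a change of coordinates. They form a real vector space. -/
def HalfDensity : Submodule ℝ (Chart n M → Coord n → ℝ) where
  carrier := {s | (∀ φ, IsLocalFunction φ (s φ)) ∧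
    ∀ φ ψ, ∀ x ∈ overlap φ ψ,
      s φ x = s ψ (transition φ ψ x) * Real.sqrt |jacobian φ ψ x|}
  add_mem' := by
    rintro s t ⟨hs, hs'⟩ ⟨ht, ht'⟩
    refine ⟨fun φ => ⟨(hs φ).1.add (ht φ).1, fun x hx => ?_⟩, fun φ ψ x hx => ?_⟩
    · simp [(hs φ).2 x hx, (ht φ).2 x hx]
    · simp only [Pi.add_apply]
      rw [hs' φ ψ x hx, ht' φ ψ x hx]
      ring
  zero_mem' := ⟨fun φ => ⟨contDiffOn_const, fun _ _ => rfl⟩, fun φ ψ x _ => by simp⟩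
  smul_mem' := by
    rintro c s ⟨hs, hs'⟩
    refine ⟨fun φ => ⟨(hs φ).1.const_smul c, fun x hx => ?_⟩, fun φ ψ x hx => ?_⟩
    · simp [(hs φ).2 x hx]
    · simp only [Pi.smul_apply, smul_eq_mul]
      rw [hs' φ ψ x hx]
      ring

variable (n M) in
/-- Smooth contravariant symmetric tensor fields `S = S^{ab} ∂_b ⊗ ∂_a` of rank 2 on `M`. -/
structure SymTensor where
  /-- The components `S^{ab}` in a coordinate system. -/
  comp : Chart n M → Fin n → Fin n → Coord n → ℝ
  smooth : ∀ φ a b, IsLocalFunction φ (comp φ a b)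
  symmetric : ∀ φ a b, comp φ a b = comp φ b a
  transform : ∀ φ ψ, ∀ x ∈ overlap φ ψ, ∀ a' b',
    comp ψ a' b' (transition φ ψ x) =
      ∑ a, ∑ b, jacobiEntry φ ψ x a' a * comp φ a b x * jacobiEntry φ ψ x b' b

variable (n M) in
/-- Families of smooth functions, one in every coordinate system, without any relation between
them. -/
abbrev ChartFunctions : Type _ :=
  {U : Chart n M → Coord n → ℝ // ∀ φ, IsLocalFunction φ (U φ)}

/-- The transformation law of a (second order) compensating field for the tensor field `S`:
`U'(x') = U(x) + 1/2 ∂_{a'} (S^{a'b'} ∂_{b'} log |J|) - 1/4 ∂_{a'} log |J| S^{a'b'} ∂_{b'} log |J|`,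
where `x` are the coordinates `φ` and `x'` are the coordinates `ψ`. -/
def IsCompensatingField (S : SymTensor n M) (U : ChartFunctions n M) : Prop :=
  ∀ φ ψ : Chart n M, ∀ x ∈ overlap φ ψ,
    U.1 ψ (transition φ ψ x) = U.1 φ x
      + (1 / 2) * ∑ a, pd a (fun y => ∑ b, S.comp ψ a b y * pd b (logJ φ ψ) y)
          (transition φ ψ x)
      - (1 / 4) * ∑ a, ∑ b, pd a (logJ φ ψ) (transition φ ψ x)
          * S.comp ψ a b (transition φ ψ x) * pd b (logJ φ ψ) (transition φ ψ x)

/-- The space of compensating fields for the tensor field `S`. -/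
def CompensatingField (S : SymTensor n M) : Type _ :=
  {U : ChartFunctions n M // IsCompensatingField S U}

/-- `D` acts, in the coordinates `φ`, as `A^{ab} ∂_b ∂_a + B^a ∂_a + C`. -/
def ActsAs (D : HalfDensity n M →ₗ[ℝ] HalfDensity n M) (φ : Chart n M)
    (A : Fin n → Fin n → Coord n → ℝ) (B : Fin n → Coord n → ℝ) (C : Coord n → ℝ) : Prop :=
  ∀ s : HalfDensity n M, ∀ x ∈ φ.1.target,
    (D s).1 φ x = ∑ a, ∑ b, A a b x * pd b (pd a (s.1 φ)) x
      + ∑ a, B a x * pd a (s.1 φ) x + C x * s.1 φ x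

/-- `D` is a differential operator of order at most two, with smooth coefficients. -/
def IsSecondOrder (D : HalfDensity n M →ₗ[ℝ] HalfDensity n M) : Prop :=
  ∀ φ : Chart n M, ∃ (A : Fin n → Fin n → Coord n → ℝ) (B : Fin n → Coord n → ℝ)
    (C : Coord n → ℝ), (∀ a b, IsLocalFunction φ (A a b)) ∧ (∀ a, IsLocalFunction φ (B a)) ∧
      IsLocalFunction φ C ∧ ActsAs D φ A B C

/-- `S` is the principal symbol of `D`: in local coordinates `D = 1/2 S^{ab} ∂_b ∂_a + …`, where the
dots stand for a differential operator of order at most one. -/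
def HasPrincipalSymbol (D : HalfDensity n M →ₗ[ℝ] HalfDensity n M) (S : SymTensor n M) : Prop :=
  ∀ φ : Chart n M, ∃ (B : Fin n → Coord n → ℝ) (C : Coord n → ℝ),
    (∀ a, IsLocalFunction φ (B a)) ∧ IsLocalFunction φ C ∧
      ActsAs D φ (fun a b x => (1 / 2) * S.comp φ a b x) B C

/-- In local coordinates `D = 1/2 (S^{ab} ∂_b ∂_a + (∂_b S^{ba}) ∂_a + U)`. -/
def HasLocalForm (D : HalfDensity n M →ₗ[ℝ] HalfDensity n M) (S : SymTensor n M)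
    (U : ChartFunctions n M) : Prop :=
  ∀ φ : Chart n M, ActsAs D φ (fun a b x => (1 / 2) * S.comp φ a b x)
    (fun a x => (1 / 2) * ∑ b, pd b (S.comp φ b a) x) (fun x => (1 / 2) * U.1 φ x)

section

variable [IsManifold 𝓘(ℝ, Coord n) ∞ M]

variable (n) in
/-- The preferred chart at a point of `M`. -/
noncomputable def preferredChart (p : M) : Chart n M :=
  ⟨chartAt (Coord n) p, IsManifold.chart_mem_maximalAtlas p⟩

/-- The set of points where the half-density does not vanish is relatively compact. (Whether the
coefficient vanishes at a point does not depend on the coordinates.) -/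
def IsCompactlySupported (s : HalfDensity n M) : Prop :=
  HasCompactSupport fun p : M => s.1 (preferredChart n p) (chartAt (Coord n) p p)

variable [T2Space M] [SigmaCompactSpace M]

variable (n M) in
/-- A smooth partition of unity subordinate to the covering of `M` by the preferred charts. -/
noncomputable def chartPartition :
    SmoothPartitionOfUnity M 𝓘(ℝ, Coord n) M Set.univ :=
  Classical.choose
    (SmoothPartitionOfUnity.exists_isSubordinate_chartAt_source 𝓘(ℝ, Coord n) M)

/-- The scalar product `⟨s, t⟩ = ∫_M s(x) t(x) |Dx|` of half-densities with compact support. The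
integral of the density `s t` over `M` is computed, as usual, by a partition of unity. -/
noncomputable def pairing (s t : HalfDensity n M) : ℝ :=
  ∑ᶠ p : M, ∫ x in (chartAt (Coord n) p).target,
    chartPartition n M p ((chartAt (Coord n) p).symm x)
      * (s.1 (preferredChart n p) x * t.1 (preferredChart n p) x)

/-- `⟨D s, t⟩ = ⟨s, D t⟩` for all half-densities `s`, `t` with compact support. -/
def IsSelfAdjointOperator (D : HalfDensity n M →ₗ[ℝ] HalfDensity n M) : Prop :=
  ∀ s t : HalfDensity n M, IsCompactlySupported s → IsCompactlySupported t →
    pairing (D s) t = pairing s (D t)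

end

end

end HalfDensities

/-! In a chart the operator reads `1/2 S^{ab} ∂_b ∂_a + B^a ∂_a + C`. Its symbol is read off by
applying it to half-densities whose coefficient near a point is a product of two coordinate
differences, because the lower order terms then contribute nothing at that point
(`exists_halfDensity_quadratic`). The commutator with a coordinate `x^c` is the first order operator
`S^{cb} ∂_b + B^c`. For a self-adjoint operator this commutator is skew, which forces `2 B^c = ∂_b
S^{bc}` (`IsSelfAdjointOperator.coeff_eq`). Hence only the divergence form `1/2 (∂_a S^{ab} ∂_b +
U)` with `U = 2 C` remains. Conversely, this form is self-adjoint by Green's identity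
(`mul_divForm_sub`) and a partition of unity.

It remains to see how `U` depends on the chart. Coefficients of a half-density are related by `s =
s' exp (L / 2)` with `L = log |J|`. A change of coordinates adds a derivative of `L` to the
divergence (`divergence_change`), and conjugation by `exp (L / 2)` cancels the resulting first order
terms because `S` is symmetric (`divForm_mul_exp`). What survives is multiplication by the function
`correction` (`divForm_transform`), so the local formulas fit together exactly when `U` is a
compensating field.

The correction depends only on `S` and the two charts, so two compensating fields differ by a global
smooth function. One exists because there is a positive half-density `σ`: take the `U` whose
operator annihilates `σ`. The same `σ` turns functions supported in a chart into global
half-densities, which supplies all test objects. -/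

namespace HalfDensities

/-! ### Partial derivatives, determinants and the divergence on `ℝⁿ`. -/

section Calculus

open Filter Topology

variable {n : ℕ} {f g : Coord n → ℝ} {x : Coord n}

lemma pd_congr (h : f =ᶠ[𝓝 x] g) (a : Fin n) : pd a f x = pd a g x := by
  simp only [pd, h.fderiv_eq]

lemma pd_eventuallyEq (h : f =ᶠ[𝓝 x] g) (a : Fin n) : pd a f =ᶠ[𝓝 x] pd a g := by
  filter_upwards [h.eventuallyEq_nhds] with y hy using pd_congr hy a

lemma fderiv_eq_sum_pd (f : Coord n → ℝ) (x v : Coord n) :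
    fderiv ℝ f x v = ∑ a, v a * pd a f x := by
  conv_lhs => rw [← (EuclideanSpace.basisFun (Fin n) ℝ).sum_repr v]
  simp [pd, map_sum]

lemma pd_add (a : Fin n) (hf : DifferentiableAt ℝ f x) (hg : DifferentiableAt ℝ g x) :
    pd a (fun y => f y + g y) x = pd a f x + pd a g x := by
  simp [pd, fderiv_fun_add hf hg]

lemma pd_sub (a : Fin n) (hf : DifferentiableAt ℝ f x) (hg : DifferentiableAt ℝ g x) :
    pd a (fun y => f y - g y) x = pd a f x - pd a g x := by
  simp [pd, fderiv_fun_sub hf hg]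

lemma pd_mul (a : Fin n) (hf : DifferentiableAt ℝ f x) (hg : DifferentiableAt ℝ g x) :
    pd a (fun y => f y * g y) x = pd a f x * g x + f x * pd a g x := by
  simp [pd, fderiv_fun_mul hf hg]; ring

@[simp] lemma pd_const (a : Fin n) (c : ℝ) : pd a (fun _ => c) x = 0 := by
  simp [pd]

lemma pd_const_mul (a : Fin n) (c : ℝ) (hf : DifferentiableAt ℝ f x) :
    pd a (fun y => c * f y) x = c * pd a f x := by
  rw [pd_mul a (by fun_prop) hf]; simp

lemma pd_sum {ι : Type*} (u : Finset ι) (a : Fin n) {F : ι → Coord n → ℝ}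
    (h : ∀ i ∈ u, DifferentiableAt ℝ (F i) x) :
    pd a (fun y => ∑ i ∈ u, F i y) x = ∑ i ∈ u, pd a (F i) x := by
  simp [pd, fderiv_fun_sum h]

lemma pd_coord (a c : Fin n) (x₀ : ℝ) :
    pd a (fun y : Coord n => y c - x₀) x = if a = c then 1 else 0 := by
  have h : HasFDerivAt (fun y : Coord n => y c - x₀)
      (EuclideanSpace.proj c : Coord n →L[ℝ] ℝ) x :=
    ((EuclideanSpace.proj c : Coord n →L[ℝ] ℝ).hasFDerivAt).sub_const x₀
  simp [pd, h.fderiv, eq_comm]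

lemma _root_.ContDiffAt.pd (a : Fin n) (hf : ContDiffAt ℝ ∞ f x) :
    ContDiffAt ℝ ∞ (pd a f) x :=
  (hf.fderiv_right (m := ∞) (by simp)).clm_apply contDiffAt_const

lemma _root_.ContDiffAt.differentiableAt_infty {F : Type*} [NormedAddCommGroup F]
    [NormedSpace ℝ F] {f : Coord n → F} (hf : ContDiffAt ℝ ∞ f x) : DifferentiableAt ℝ f x :=
  hf.differentiableAt (by simp)

lemma _root_.ContDiffAt.eventually_differentiableAt (hf : ContDiffAt ℝ ∞ f x) :
    ∀ᶠ y in 𝓝 x, DifferentiableAt ℝ f y := by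
  filter_upwards [(hf.of_le (m := 1) (WithTop.coe_le_coe.2 le_top)).eventually (by simp)] with y hy
    using hy.differentiableAt one_ne_zero

lemma two_le_infty : minSmoothness ℝ 2 ≤ (∞ : WithTop ℕ∞) := by
  rw [minSmoothness_of_isRCLikeNormedField]
  exact WithTop.coe_le_coe.2 (le_top : (2 : ℕ∞) ≤ ⊤)

lemma pd_pd_comm (a b : Fin n) (hf : ContDiffAt ℝ ∞ f x) :
    pd a (pd b f) x = pd b (pd a f) x := by
  have h := hf.isSymmSndFDerivAt two_le_infty
  have hd : DifferentiableAt ℝ (fderiv ℝ f) x :=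
    (hf.fderiv_right (m := ∞) (by simp)).differentiableAt_infty
  have key : ∀ a b : Fin n, pd a (pd b f) x =
      fderiv ℝ (fderiv ℝ f) x (EuclideanSpace.single a 1) (EuclideanSpace.single b 1) := by
    intro a b
    change fderiv ℝ (fun y => fderiv ℝ f y (EuclideanSpace.single b 1)) x _ = _
    rw [fderiv_clm_apply hd (by fun_prop)]
    simp
  rw [key, key, h]

lemma pd_pd_mul (a b : Fin n) (hf : ContDiffAt ℝ ∞ f x) (hg : ContDiffAt ℝ ∞ g x) :
    pd b (pd a fun y => f y * g y) x = pd b (pd a f) x * g x + pd a f x * pd b g x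
      + pd b f x * pd a g x + f x * pd b (pd a g) x := by
  have h : pd a (fun y => f y * g y) =ᶠ[𝓝 x] fun y => pd a f y * g y + f y * pd a g y := by
    filter_upwards [hf.eventually_differentiableAt, hg.eventually_differentiableAt] with y h1 h2
    exact pd_mul a h1 h2
  have h1 := hf.differentiableAt_infty
  have h2 := hg.differentiableAt_infty
  have h3 := (hf.pd a).differentiableAt_infty
  have h4 := (hg.pd a).differentiableAt_infty
  rw [pd_congr h, pd_add (f := fun y => pd a f y * g y) (g := fun y => f y * pd a g y) b
    (h3.mul h2) (h1.mul h4), pd_mul b h3 h2, pd_mul b h1 h4]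
  ring

/-- The chain rule for partial derivatives. -/
lemma pd_comp {T : Coord n → Coord n} (hT : DifferentiableAt ℝ T x)
    (hf : DifferentiableAt ℝ f (T x)) (a : Fin n) :
    pd a (fun y => f (T y)) x =
      ∑ a', fderiv ℝ T x (EuclideanSpace.single a 1) a' * pd a' f (T x) := by
  have h : pd a (fun y => f (T y)) x = fderiv ℝ f (T x) (fderiv ℝ T x (EuclideanSpace.single a 1)) := by
    change fderiv ℝ (f ∘ T) x _ = _
    rw [fderiv_comp x hf hT]; rfl
  rw [h, fderiv_eq_sum_pd]

/-- The divergence of a vector field on `ℝⁿ`. -/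
noncomputable def divergence (X : Coord n → Coord n) (x : Coord n) : ℝ :=
  ∑ a, pd a (fun y => X y a) x

lemma trace_eq_sum (A : Coord n →L[ℝ] Coord n) :
    LinearMap.trace ℝ _ (A : Coord n →ₗ[ℝ] Coord n) = ∑ a, A (EuclideanSpace.single a 1) a := by
  rw [LinearMap.trace_eq_sum_inner _ (EuclideanSpace.basisFun (Fin n) ℝ)]
  simp [EuclideanSpace.inner_single_left]

lemma pd_apply {X : Coord n → Coord n} (hX : DifferentiableAt ℝ X x) (a b : Fin n) :
    pd a (fun y => X y b) x = fderiv ℝ X x (EuclideanSpace.single a 1) b := by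
  have h : HasFDerivAt (fun y => X y b)
      ((EuclideanSpace.proj b : Coord n →L[ℝ] ℝ).comp (fderiv ℝ X x)) x :=
    (EuclideanSpace.proj b : Coord n →L[ℝ] ℝ).hasFDerivAt.comp x hX.hasFDerivAt
  rw [pd, h.fderiv]; rfl

lemma divergence_eq_trace {X : Coord n → Coord n} (hX : DifferentiableAt ℝ X x) :
    divergence X x = LinearMap.trace ℝ _ (fderiv ℝ X x : Coord n →ₗ[ℝ] Coord n) := by
  rw [trace_eq_sum]
  exact Finset.sum_congr rfl fun a _ => pd_apply hX a a

lemma det_eq_sum (A : Coord n →L[ℝ] Coord n) :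
    A.det = Matrix.det (Matrix.of fun i j => A (EuclideanSpace.single j 1) i) := by
  rw [ContinuousLinearMap.det, ← LinearMap.det_toMatrix (EuclideanSpace.basisFun (Fin n) ℝ).toBasis]
  congr 1

lemma contDiff_det : ContDiff ℝ ∞ (fun A : Coord n →L[ℝ] Coord n => A.det) := by
  simp only [det_eq_sum, Matrix.det_apply, Matrix.of_apply]
  refine ContDiff.sum fun σ _ => ContDiff.const_smul _ (contDiff_prod fun i _ => ?_)
  exact ((EuclideanSpace.proj (σ i) : Coord n →L[ℝ] ℝ).comp
    (ContinuousLinearMap.apply ℝ (Coord n) (EuclideanSpace.single i (1 : ℝ)))).contDiff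

/-- Along the line `1 + t H` the determinant is `1 + t tr H` plus `t²` times a polynomial in `t`. As
`det` is already known to be differentiable, this directional derivative determines the value at
`H`. -/
lemma fderiv_det_one (H : Coord n →L[ℝ] Coord n) :
    fderiv ℝ (fun A : Coord n →L[ℝ] Coord n => A.det) (ContinuousLinearMap.id ℝ _) H =
      LinearMap.trace ℝ _ (H : Coord n →ₗ[ℝ] Coord n) := by
  have hd : HasFDerivAt (fun A : Coord n →L[ℝ] Coord n => A.det) _ (ContinuousLinearMap.id ℝ _) :=
    ((contDiff_det (n := n)).differentiable (by simp) _).hasFDerivAt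
  have hl : HasDerivAt (fun t : ℝ => ContinuousLinearMap.id ℝ (Coord n) + t • H) H 0 := by
    simpa using ((hasDerivAt_id (0 : ℝ)).smul_const H).const_add (ContinuousLinearMap.id ℝ (Coord n))
  have h1 := hd.comp_hasDerivAt_of_eq (0 : ℝ) hl (by ext v; simp)
  set N : Matrix (Fin n) (Fin n) ℝ := Matrix.of fun i j => H (EuclideanSpace.single j 1) i with hN
  have h2 : (fun t : ℝ => (ContinuousLinearMap.id ℝ (Coord n) + t • H).det) =
      fun t => 1 + N.trace * t + Polynomial.eval t (1 + (Polynomial.X : Polynomial ℝ) • N.map Polynomial.C).det.divX.divX * t ^ 2 := by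
    funext t
    rw [← Matrix.det_one_add_smul, det_eq_sum]
    congr 1
    ext i j
    simp [hN, Matrix.one_apply]
  have h3 : HasDerivAt (fun t : ℝ => (ContinuousLinearMap.id ℝ (Coord n) + t • H).det) N.trace 0 := by
    rw [h2]
    have hp := ((1 + (Polynomial.X : Polynomial ℝ) • N.map Polynomial.C).det.divX.divX).hasDerivAt (0 : ℝ)
    have := (((hasDerivAt_id (0 : ℝ)).const_mul N.trace).const_add 1).add
      (hp.mul ((hasDerivAt_id (0 : ℝ)).pow 2))
    exact this.congr_deriv (by simp)
  rw [trace_eq_sum]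
  refine Eq.trans ?_ (h1.unique h3)
  rfl

/-- Jacobi's formula for the logarithmic derivative of a determinant. -/
lemma fderiv_log_abs_det {A : Coord n → Coord n →L[ℝ] Coord n} (hA : DifferentiableAt ℝ A x)
    {K : Coord n →L[ℝ] Coord n} (hK : K.comp (A x) = ContinuousLinearMap.id ℝ _) (v : Coord n) :
    fderiv ℝ (fun y => Real.log |(A y).det|) x v =
      LinearMap.trace ℝ _ ((K.comp (fderiv ℝ A x v) : Coord n →L[ℝ] Coord n) : Coord n →ₗ[ℝ] Coord n) := by
  have hdet : ∀ B : Coord n →L[ℝ] Coord n, (K.comp B).det = K.det * B.det := fun B => by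
    simp [ContinuousLinearMap.det]
  have hone : K.det * (A x).det = 1 := by
    rw [← hdet, hK]; simp [ContinuousLinearMap.det]
  have hK0 : K.det ≠ 0 := left_ne_zero_of_mul_eq_one hone
  have hA0 : (A x).det ≠ 0 := right_ne_zero_of_mul_eq_one hone
  have hdA : DifferentiableAt ℝ (fun y => (A y).det) x :=
    ((contDiff_det (n := n)).differentiable (by simp) _).comp x hA
  have h1 : fderiv ℝ (fun y => Real.log |(A y).det|) x v =
      ((A x).det)⁻¹ * fderiv ℝ (fun y => (A y).det) x v := by
    simp only [Real.log_abs]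
    rw [fderiv.log hdA hA0]; simp
  -- The constant factor `K` moves the base point from `A x` to the identity, where the derivative
  -- of `det` is the trace; it multiplies the determinant by `det K = (det A x)⁻¹`.
  have hKA : HasFDerivAt (fun y => K.comp (A y)) _ x :=
    ((ContinuousLinearMap.compL ℝ (Coord n) (Coord n) (Coord n) K).hasFDerivAt).comp x hA.hasFDerivAt
  have h2 : HasFDerivAt (fun y => (K.comp (A y)).det) _ x :=
    ((contDiff_det (n := n)).differentiable (by simp) _).hasFDerivAt.comp x hKA
  have h3 : HasFDerivAt (fun y => (K.comp (A y)).det) (K.det • fderiv ℝ (fun y => (A y).det) x) x := by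
    simp only [hdet]
    exact hdA.hasFDerivAt.const_mul _
  have h4 := congrArg (fun l => l v) (h2.unique h3)
  simp only [hK] at h4
  rw [h1]
  have h5 : ((A x).det)⁻¹ = K.det := by
    rw [inv_eq_iff_eq_inv, eq_comm, inv_eq_of_mul_eq_one_right hone]
  rw [h5]
  refine (h4.symm.trans ?_)
  exact fderiv_det_one _

/-- The divergence of a vector field in new coordinates. -/
lemma divergence_change {T : Coord n → Coord n} {X Y : Coord n → Coord n}
    (hT : ContDiffAt ℝ ∞ T x) {K : Coord n →L[ℝ] Coord n}
    (hK : K.comp (fderiv ℝ T x) = ContinuousLinearMap.id ℝ _)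
    (hK' : (fderiv ℝ T x).comp K = ContinuousLinearMap.id ℝ _)
    (hX : DifferentiableAt ℝ X x) (hY : DifferentiableAt ℝ Y (T x))
    (hXY : ∀ᶠ y in 𝓝 x, Y (T y) = fderiv ℝ T y (X y)) :
    divergence Y (T x) = divergence X x
      + ∑ a, X x a * pd a (fun y => Real.log |(fderiv ℝ T y).det|) x := by
  have hA : DifferentiableAt ℝ (fderiv ℝ T) x :=
    (hT.fderiv_right (m := ∞) (by simp)).differentiableAt_infty
  have hsymm := hT.isSymmSndFDerivAt two_le_infty
  have h1 : HasFDerivAt (fun y => Y (T y)) ((fderiv ℝ Y (T x)).comp (fderiv ℝ T x)) x :=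
    hY.hasFDerivAt.comp x hT.differentiableAt_infty.hasFDerivAt
  have h2 : HasFDerivAt (fun y => Y (T y)) _ x :=
    (hA.hasFDerivAt.clm_apply hX.hasFDerivAt).congr_of_eventuallyEq hXY
  have h3 := h1.unique h2
  -- Differentiating `Y ∘ T = T' X` gives a term `T''(v)(X x)`. Symmetry of `T''` makes `X x` the
  -- direction of differentiation, so the extra trace becomes the derivative of `log |det T'|` along
  -- `X`.
  have h4 : fderiv ℝ Y (T x) = ((fderiv ℝ T x).comp (fderiv ℝ X x)
      + (fderiv ℝ (fderiv ℝ T) x) (X x)).comp K := by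
    have h5 : (fderiv ℝ Y (T x)).comp ((fderiv ℝ T x).comp K) =
      ((fderiv ℝ T x).comp (fderiv ℝ X x) + (fderiv ℝ (fderiv ℝ T) x) (X x)).comp K := by
      rw [← ContinuousLinearMap.comp_assoc, h3]
      congr 1
      congr 1
      ext v : 1
      simpa using hsymm v (X x)
    rwa [hK', ContinuousLinearMap.comp_id] at h5
  rw [divergence_eq_trace hY, divergence_eq_trace hX, h4, ← fderiv_eq_sum_pd,
    fderiv_log_abs_det hA hK]
  set P := fderiv ℝ T x
  set Q := fderiv ℝ X x
  set R := (fderiv ℝ (fderiv ℝ T) x) (X x)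
  have hcyc : ∀ G H : Coord n →L[ℝ] Coord n, LinearMap.trace ℝ _ ((G.comp H : Coord n →L[ℝ] Coord n) : Coord n →ₗ[ℝ] Coord n)
      = LinearMap.trace ℝ _ ((H.comp G : Coord n →L[ℝ] Coord n) : Coord n →ₗ[ℝ] Coord n) :=
    fun G H => LinearMap.trace_mul_comm ℝ (G : Coord n →ₗ[ℝ] Coord n) H
  rw [hcyc, ContinuousLinearMap.comp_add, ← ContinuousLinearMap.comp_assoc, hK,
    ContinuousLinearMap.id_comp]
  simp

end Calculus

/-! ### Changes of coordinates and their Jacobians. -/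

section Charts

open Filter Topology

variable {n : ℕ} {M : Type*} [TopologicalSpace M] [ChartedSpace (Coord n) M]
  {φ ψ χ : Chart n M} {x : Coord n}

lemma mem_overlap : x ∈ overlap φ ψ ↔ x ∈ φ.1.target ∧ φ.1.symm x ∈ ψ.1.source := by
  simp [overlap]

lemma isOpen_overlap (φ ψ : Chart n M) : IsOpen (overlap φ ψ) :=
  (φ.1.symm.trans ψ.1).open_source

lemma overlap_mem_nhds (hx : x ∈ overlap φ ψ) : overlap φ ψ ∈ 𝓝 x :=
  (isOpen_overlap φ ψ).mem_nhds hx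

lemma symm_transition (hx : x ∈ overlap φ ψ) : ψ.1.symm (transition φ ψ x) = φ.1.symm x :=
  ψ.1.left_inv (mem_overlap.1 hx).2

lemma transition_mem_target (hx : x ∈ overlap φ ψ) : transition φ ψ x ∈ ψ.1.target :=
  ψ.1.map_source (mem_overlap.1 hx).2

lemma transition_mem_overlap (hx : x ∈ overlap φ ψ) : transition φ ψ x ∈ overlap ψ φ := by
  rw [mem_overlap, symm_transition hx]
  exact ⟨transition_mem_target hx, φ.1.map_target (mem_overlap.1 hx).1⟩

lemma transition_transition (hx : x ∈ overlap φ ψ) : transition ψ φ (transition φ ψ x) = x := by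
  rw [transition, symm_transition hx, φ.1.right_inv (mem_overlap.1 hx).1]

lemma image_transition (φ ψ : Chart n M) : transition φ ψ '' overlap φ ψ = overlap ψ φ := by
  ext y
  constructor
  · rintro ⟨x, hx, rfl⟩
    exact transition_mem_overlap hx
  · intro hy
    exact ⟨_, transition_mem_overlap hy, transition_transition hy⟩

lemma injOn_transition (φ ψ : Chart n M) : Set.InjOn (transition φ ψ) (overlap φ ψ) := by
  intro x hx y hy h
  rw [← transition_transition hx, h, transition_transition hy]

lemma contDiffAt_transition (hx : x ∈ overlap φ ψ) : ContDiffAt ℝ ∞ (transition φ ψ) x := by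
  have h := IsManifold.compatible_of_mem_maximalAtlas φ.2 ψ.2
  rw [contDiffGroupoid, mem_groupoid_of_pregroupoid] at h
  have h1 : ContDiffOn ℝ ∞ (transition φ ψ) (overlap φ ψ) := by
    change ContDiffOn ℝ ∞ (fun x => ψ.1 (φ.1.symm x)) _
    simpa [contDiffPregroupoid, overlap, transition, Function.comp_def, Set.preimage] using h.1
  exact h1.contDiffAt (overlap_mem_nhds hx)

lemma fderiv_transition_comp (hx : x ∈ overlap φ ψ) :
    (fderiv ℝ (transition ψ φ) (transition φ ψ x)).comp (fderiv ℝ (transition φ ψ) x) =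
      ContinuousLinearMap.id ℝ _ := by
  have h1 := (contDiffAt_transition (transition_mem_overlap hx)).differentiableAt_infty
  have h2 := (contDiffAt_transition hx).differentiableAt_infty
  rw [← fderiv_comp x h1 h2]
  have h3 : transition ψ φ ∘ transition φ ψ =ᶠ[𝓝 x] id := by
    filter_upwards [overlap_mem_nhds hx] with y hy using transition_transition hy
  rw [h3.fderiv_eq, fderiv_id]

lemma fderiv_transition_comp' (hx : x ∈ overlap φ ψ) :
    (fderiv ℝ (transition φ ψ) x).comp (fderiv ℝ (transition ψ φ) (transition φ ψ x)) =
      ContinuousLinearMap.id ℝ _ := by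
  have h := fderiv_transition_comp (transition_mem_overlap hx)
  rwa [transition_transition hx] at h

lemma det_comp (A B : Coord n →L[ℝ] Coord n) : (A.comp B).det = A.det * B.det := by
  simp [ContinuousLinearMap.det]

lemma jacobian_mul (hx : x ∈ overlap φ ψ) (hx' : φ.1.symm x ∈ χ.1.source) :
    jacobian φ χ x = jacobian ψ χ (transition φ ψ x) * jacobian φ ψ x := by
  have hy : transition φ ψ x ∈ overlap ψ χ :=
    mem_overlap.2 ⟨transition_mem_target hx, by rwa [symm_transition hx]⟩
  rw [jacobian, jacobian, jacobian, ← det_comp,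
    ← fderiv_comp x (contDiffAt_transition hy).differentiableAt_infty
      (contDiffAt_transition hx).differentiableAt_infty]
  congr 1
  refine Filter.EventuallyEq.fderiv_eq ?_
  filter_upwards [overlap_mem_nhds hx] with y hy
  simp only [Function.comp, transition, ψ.1.left_inv (mem_overlap.1 hy).2]

lemma jacobian_mul_symm (hx : x ∈ overlap φ ψ) :
    jacobian ψ φ (transition φ ψ x) * jacobian φ ψ x = 1 := by
  rw [jacobian, jacobian, ← det_comp, fderiv_transition_comp hx]
  simp [ContinuousLinearMap.det]

lemma jacobian_ne_zero (hx : x ∈ overlap φ ψ) : jacobian φ ψ x ≠ 0 :=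
  right_ne_zero_of_mul_eq_one (jacobian_mul_symm hx)

lemma contDiffAt_jacobian (hx : x ∈ overlap φ ψ) : ContDiffAt ℝ ∞ (jacobian φ ψ) x :=
  contDiff_det.contDiffAt.comp x ((contDiffAt_transition hx).fderiv_right (by simp))

lemma sqrt_abs_jacobian_pos (hx : x ∈ overlap φ ψ) : 0 < Real.sqrt |jacobian φ ψ x| :=
  Real.sqrt_pos.2 (abs_pos.2 (jacobian_ne_zero hx))

lemma contDiffAt_sqrt_abs_jacobian (hx : x ∈ overlap φ ψ) :
    ContDiffAt ℝ ∞ (fun y => Real.sqrt |jacobian φ ψ y|) x :=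
  (((contDiffAt_abs (jacobian_ne_zero hx)).comp x (contDiffAt_jacobian hx)).sqrt
    (abs_ne_zero.2 (jacobian_ne_zero hx)))

lemma logJ_transition (hx : x ∈ overlap φ ψ) :
    logJ φ ψ (transition φ ψ x) = Real.log |jacobian φ ψ x| := by
  rw [logJ, transition_transition hx]

lemma contDiffAt_logJ (hx : x ∈ overlap ψ φ) : ContDiffAt ℝ ∞ (logJ φ ψ) x := by
  have h := transition_mem_overlap hx
  refine ((contDiffAt_abs (jacobian_ne_zero h)).comp _ (contDiffAt_jacobian h)).comp x
    (contDiffAt_transition hx) |>.log ?_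
  exact abs_ne_zero.2 (jacobian_ne_zero h)

lemma sqrt_abs_jacobian_eq_exp (hx : x ∈ overlap ψ φ) :
    Real.sqrt |jacobian φ ψ (transition ψ φ x)| = Real.exp (logJ φ ψ x / 2) := by
  have h := jacobian_ne_zero (transition_mem_overlap hx)
  rw [Real.exp_half, logJ, Real.exp_log (abs_pos.2 h)]

lemma IsLocalFunction.contDiffAt {f : Coord n → ℝ} (hf : IsLocalFunction φ f)
    (hx : x ∈ φ.1.target) : ContDiffAt ℝ ∞ f x :=
  hf.1.contDiffAt (φ.1.open_target.mem_nhds hx)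

lemma isLocalFunction_indicator {f : Coord n → ℝ} (hf : ∀ x ∈ φ.1.target, ContDiffAt ℝ ∞ f x) :
    IsLocalFunction φ (φ.1.target.indicator f) := by
  refine ⟨fun x hx => ?_, fun x hx => Set.indicator_of_notMem hx f⟩
  refine ((hf x hx).contDiffWithinAt).congr (fun y hy => Set.indicator_of_mem hy f)
    (Set.indicator_of_mem hx f)

lemma IsLocalFunction.ext {f g : Coord n → ℝ} (hf : IsLocalFunction φ f)
    (hg : IsLocalFunction φ g) (h : ∀ x ∈ φ.1.target, f x = g x) : f = g := by
  funext x
  by_cases hx : x ∈ φ.1.target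
  · exact h x hx
  · rw [hf.2 x hx, hg.2 x hx]

end Charts

/-! ### The operator `∂_a (S^{ab} ∂_b ·)` in one coordinate system. -/

section DivergenceForm

open Filter Topology

variable {n : ℕ} {x : Coord n}

/-- The differential operator `u ↦ ∂_a (S^{ab} ∂_b u)`. -/
noncomputable def divForm (S : Fin n → Fin n → Coord n → ℝ) (u : Coord n → ℝ) (x : Coord n) : ℝ :=
  ∑ a, pd a (fun y => ∑ b, S a b y * pd b u y) x

/-- The correction term of the transformation law of compensating fields. -/
noncomputable def correction (S : Fin n → Fin n → Coord n → ℝ) (L : Coord n → ℝ) (x : Coord n) :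
    ℝ :=
  (1 / 2) * divForm S L x - (1 / 4) * ∑ a, ∑ b, pd a L x * S a b x * pd b L x

lemma contDiffAt_flux {S : Fin n → Fin n → Coord n → ℝ} {u : Coord n → ℝ}
    (hS : ∀ a b, ContDiffAt ℝ ∞ (S a b) x) (hu : ContDiffAt ℝ ∞ u x) (a : Fin n) :
    ContDiffAt ℝ ∞ (fun y => ∑ b, S a b y * pd b u y) x :=
  ContDiffAt.sum fun b _ => (hS a b).mul (hu.pd b)

lemma contDiffAt_divForm {S : Fin n → Fin n → Coord n → ℝ} {u : Coord n → ℝ}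
    (hS : ∀ a b, ContDiffAt ℝ ∞ (S a b) x) (hu : ContDiffAt ℝ ∞ u x) :
    ContDiffAt ℝ ∞ (divForm S u) x :=
  ContDiffAt.sum fun a _ => (contDiffAt_flux hS hu a).pd a

lemma divForm_eq {S : Fin n → Fin n → Coord n → ℝ} {u : Coord n → ℝ}
    (hS : ∀ a b, ContDiffAt ℝ ∞ (S a b) x) (hu : ContDiffAt ℝ ∞ u x) :
    divForm S u x = ∑ a, ∑ b, S a b x * pd b (pd a u) x
      + ∑ a, (∑ b, pd b (S b a) x) * pd a u x := by
  have h : ∀ a, pd a (fun y => ∑ b, S a b y * pd b u y) x =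
      ∑ b, (pd a (S a b) x * pd b u x + S a b x * pd b (pd a u) x) := fun a => by
    rw [pd_sum _ _ fun b _ => ((hS a b).mul (hu.pd b)).differentiableAt_infty]
    refine Finset.sum_congr rfl fun b _ => ?_
    rw [pd_mul a (hS a b).differentiableAt_infty (hu.pd b).differentiableAt_infty,
      pd_pd_comm a b hu]
  simp only [divForm, h, Finset.sum_add_distrib, Finset.sum_mul]
  rw [add_comm]
  congr 1
  exact Finset.sum_comm

/-- The operator `∂_a (S^{ab} ∂_b ·)` conjugated by `exp (L / 2)`. -/
lemma divForm_mul_exp {S : Fin n → Fin n → Coord n → ℝ} {u L g : Coord n → ℝ}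
    (hS : ∀ a b, ContDiffAt ℝ ∞ (S a b) x) (hsymm : ∀ a b, S a b x = S b a x)
    (hu : ContDiffAt ℝ ∞ u x) (hL : ContDiffAt ℝ ∞ L x)
    (hg : g =ᶠ[𝓝 x] fun y => u y * Real.exp (L y / 2)) :
    divForm S g x - ∑ a, (∑ b, S a b x * pd b g x) * pd a L x =
      Real.exp (L x / 2) * (divForm S u x + correction S L x * u x) := by
  have hexp : ∀ {y : Coord n}, DifferentiableAt ℝ L y → ∀ a, pd a (fun y => Real.exp (L y / 2)) y =
      Real.exp (L y / 2) * (pd a L y / 2) := fun {y} h a => by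
    have h1 := ((h.hasFDerivAt.mul_const (2⁻¹ : ℝ)).exp).fderiv
    simp only [← div_eq_mul_inv] at h1
    simp only [pd, h1]
    simp; ring
  have hE : ContDiffAt ℝ ∞ (fun y => Real.exp (L y / 2)) x := (hL.div_const 2).exp
  -- The product rule for `u exp (L / 2)`, needed as an identity of germs because the flux is
  -- differentiated once more.
  have hflux : ∀ a, (fun y => ∑ b, S a b y * pd b g y) =ᶠ[𝓝 x] fun y =>
      Real.exp (L y / 2) * ((∑ b, S a b y * pd b u y)
        + (1 / 2) * (u y * ∑ b, S a b y * pd b L y)) := fun a => by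
    filter_upwards [hg.eventuallyEq_nhds, hu.eventually_differentiableAt,
      hL.eventually_differentiableAt] with y hy h1 h2
    simp only [Finset.mul_sum, mul_add, ← Finset.sum_add_distrib]
    refine Finset.sum_congr rfl fun b _ => ?_
    rw [pd_congr hy, pd_mul b h1 (by fun_prop), hexp h2]
    ring
  set P := fun a y => ∑ b, S a b y * pd b u y with hP
  set Q := fun a y => ∑ b, S a b y * pd b L y with hQ
  have hPs : ∀ a, ContDiffAt ℝ ∞ (P a) x := fun a => contDiffAt_flux hS hu a
  have hQs : ∀ a, ContDiffAt ℝ ∞ (Q a) x := fun a => contDiffAt_flux hS hL a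
  have hpd : ∀ a, pd a (fun y => ∑ b, S a b y * pd b g y) x =
      Real.exp (L x / 2) * ((pd a L x / 2) * (P a x + (1 / 2) * (u x * Q a x))
        + pd a (P a) x + (1 / 2) * (pd a u x * Q a x + u x * pd a (Q a) x)) := fun a => by
    have h1 := (hPs a).differentiableAt_infty
    have h2 := (hQs a).differentiableAt_infty
    have h3 := hu.differentiableAt_infty
    have h4 : DifferentiableAt ℝ (fun y => u y * Q a y) x := h3.mul h2
    have h5 : DifferentiableAt ℝ (fun y => (1 / 2) * (u y * Q a y)) x := h4.const_mul _
    have h6 : DifferentiableAt ℝ (fun y => P a y + (1 / 2) * (u y * Q a y)) x := h1.add h5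
    rw [pd_congr (hflux a), pd_mul a hE.differentiableAt_infty h6,
      hexp hL.differentiableAt_infty, pd_add a h1 h5, pd_const_mul a _ h4, pd_mul a h3 h2]
    ring
  -- Symmetry of `S` enters here: it cancels the terms with first derivatives of `u` that come from
  -- `L`, so that only multiplication by a function is left.
  have hPQ : ∑ a, pd a L x * P a x = ∑ a, pd a u x * Q a x := by
    simp only [hP, hQ, Finset.mul_sum]
    rw [Finset.sum_comm]
    refine Finset.sum_congr rfl fun a _ => Finset.sum_congr rfl fun b _ => ?_
    rw [hsymm a b]; ring
  have hq : ∑ a, ∑ b, pd a L x * S a b x * pd b L x = ∑ a, pd a L x * Q a x := by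
    simp only [hQ, Finset.mul_sum, mul_assoc]
  rw [correction, hq, divForm]
  simp only [hpd]
  have hfx : ∀ a, ∑ b, S a b x * pd b g x = Real.exp (L x / 2) * (P a x
        + (1 / 2) * (u x * Q a x)) := fun a => (hflux a).eq_of_nhds
  simp only [hfx]
  change _ = Real.exp (L x / 2) * ((∑ a, pd a (P a) x) +
    ((1 / 2) * (∑ a, pd a (Q a) x) - (1 / 4) * ∑ a, pd a L x * Q a x) * u x)
  have hlin : ∑ a, Real.exp (L x / 2) * ((pd a L x / 2) * (P a x + (1 / 2) * (u x * Q a x))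
        + pd a (P a) x + (1 / 2) * (pd a u x * Q a x + u x * pd a (Q a) x)) -
      ∑ a, Real.exp (L x / 2) * (P a x + (1 / 2) * (u x * Q a x)) * pd a L x =
      Real.exp (L x / 2) * ((∑ a, pd a (P a) x) + (1 / 2) * u x * (∑ a, pd a (Q a) x)
        - (1 / 4) * u x * (∑ a, pd a L x * Q a x)
        + (1 / 2) * ((∑ a, pd a u x * Q a x) - ∑ a, pd a L x * P a x)) := by
    simp only [mul_sub, mul_add, Finset.mul_sum, ← Finset.sum_add_distrib,
      ← Finset.sum_sub_distrib]
    refine Finset.sum_congr rfl fun a _ => ?_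
    ring
  rw [hlin, hPQ]
  ring

end DivergenceForm

/-! ### The divergence form under a change of coordinates. -/

section Transformation

open Filter Topology

variable {n : ℕ} {M : Type*} [TopologicalSpace M] [ChartedSpace (Coord n) M]
  {φ ψ : Chart n M} {x : Coord n}

/-- The transformation of the operator `∂_a (S^{ab} ∂_b ·)` on half-densities. -/
lemma divForm_transform (S : SymTensor n M) (s : HalfDensity n M) (hx : x ∈ overlap φ ψ) :
    divForm (S.comp φ) (s.1 φ) x = Real.sqrt |jacobian φ ψ x| *
      (divForm (S.comp ψ) (s.1 ψ) (transition φ ψ x)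
        + correction (S.comp ψ) (logJ φ ψ) (transition φ ψ x) * s.1 ψ (transition φ ψ x)) := by
  set T := transition φ ψ with hT
  have hx' := transition_mem_overlap hx
  have hxt := (mem_overlap.1 hx).1
  have hTs : ContDiffAt ℝ ∞ T x := contDiffAt_transition hx
  have hsφ : ∀ y ∈ overlap φ ψ, ContDiffAt ℝ ∞ (s.1 φ) y := fun y hy =>
    (s.2.1 φ).contDiffAt (mem_overlap.1 hy).1
  have hSφ : ∀ a b, ContDiffAt ℝ ∞ (S.comp φ a b) x := fun a b => (S.smooth φ a b).contDiffAt hxt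
  have hSψ : ∀ a b, ContDiffAt ℝ ∞ (S.comp ψ a b) (T x) := fun a b =>
    (S.smooth ψ a b).contDiffAt (transition_mem_target hx)
  have hL : ContDiffAt ℝ ∞ (logJ φ ψ) (T x) := contDiffAt_logJ hx'
  -- The coefficient in `φ` is transported as a scalar function, without its weight; the weight is
  -- put back by `hge`.
  set g : Coord n → ℝ := fun y => s.1 φ (transition ψ φ y) with hg
  have hgs : ∀ y ∈ overlap φ ψ, ContDiffAt ℝ ∞ g (T y) := fun y hy => by
    refine ContDiffAt.comp (T y) ?_ (contDiffAt_transition (transition_mem_overlap hy))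
    rw [hT, transition_transition hy]
    exact hsφ y hy
  have hpds : ∀ y ∈ overlap φ ψ, ∀ b, pd b (s.1 φ) y =
      ∑ b', jacobiEntry φ ψ y b' b * pd b' g (T y) := fun y hy b => by
    have h : s.1 φ =ᶠ[𝓝 y] fun z => g (T z) := by
      filter_upwards [overlap_mem_nhds hy] with z hz
      simp only [hg, hT, transition_transition hz]
    rw [pd_congr h, pd_comp (contDiffAt_transition hy).differentiableAt_infty
      (hgs y hy).differentiableAt_infty]
    rfl
  -- The flux `S^{ab} ∂_b s` of a scalar is a vector field; `X` and `Y` are its components in the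
  -- two charts, so `divergence_change` applies.
  let X : Coord n → Coord n := fun y => WithLp.toLp 2 fun a => ∑ b, S.comp φ a b y * pd b (s.1 φ) y
  let Y : Coord n → Coord n := fun y => WithLp.toLp 2 fun a => ∑ b, S.comp ψ a b y * pd b g y
  have hXs : DifferentiableAt ℝ X x := by
    rw [differentiableAt_euclidean]
    exact fun a => (contDiffAt_flux hSφ (hsφ x hx) a).differentiableAt_infty
  have hYs : DifferentiableAt ℝ Y (T x) := by
    rw [differentiableAt_euclidean]
    exact fun a => (contDiffAt_flux hSψ (hgs x hx) a).differentiableAt_infty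
  have hXY : ∀ y ∈ overlap φ ψ, Y (T y) = fderiv ℝ T y (X y) := fun y hy => by
    ext a'
    have h1 : fderiv ℝ T y (X y) a' = ∑ a, X y a * jacobiEntry φ ψ y a' a := by
      conv_lhs => rw [← (EuclideanSpace.basisFun (Fin n) ℝ).sum_repr (X y)]
      simp [map_sum, jacobiEntry, hT]
    rw [h1]
    simp only [X, Y, hpds y hy]
    simp only [hT, S.transform φ ψ y hy, Finset.sum_mul, Finset.mul_sum]
    rw [Finset.sum_comm]
    refine Finset.sum_congr rfl fun a _ => ?_
    rw [Finset.sum_comm]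
    refine Finset.sum_congr rfl fun b _ => Finset.sum_congr rfl fun b' _ => ?_
    ring
  have hXYe : ∀ᶠ y in 𝓝 x, Y (T y) = fderiv ℝ T y (X y) := by
    filter_upwards [overlap_mem_nhds hx] with y hy using hXY y hy
  have hdiv := divergence_change hTs (fderiv_transition_comp hx) (fderiv_transition_comp' hx)
    hXs hYs hXYe
  have hlog : ∑ a, X x a * pd a (fun y => Real.log |(fderiv ℝ T y).det|) x =
      ∑ a, Y (T x) a * pd a (logJ φ ψ) (T x) := by
    rw [← fderiv_eq_sum_pd, ← fderiv_eq_sum_pd, hXY x hx]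
    have h : (fun y => Real.log |(fderiv ℝ T y).det|) =ᶠ[𝓝 x] logJ φ ψ ∘ T := by
      filter_upwards [overlap_mem_nhds hx] with y hy
      exact (logJ_transition hy).symm
    rw [h.fderiv_eq, fderiv_comp x hL.differentiableAt_infty hTs.differentiableAt_infty]
    rfl
  rw [hlog] at hdiv
  have hge : g =ᶠ[𝓝 (T x)] fun y => s.1 ψ y * Real.exp (logJ φ ψ y / 2) := by
    filter_upwards [overlap_mem_nhds hx'] with y hy
    rw [← sqrt_abs_jacobian_eq_exp hy, hg]
    have := s.2.2 φ ψ _ (transition_mem_overlap hy)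
    rwa [transition_transition hy] at this
  have hmain := divForm_mul_exp hSψ (fun a b => congrFun (S.symmetric ψ a b) _)
    ((s.2.1 ψ).contDiffAt (transition_mem_target hx)) hL hge
  rw [← sqrt_abs_jacobian_eq_exp hx', hT, transition_transition hx] at hmain
  rw [← hmain]
  exact eq_sub_of_add_eq hdiv.symm

lemma isCompensatingField_iff (S : SymTensor n M) (U : ChartFunctions n M) :
    IsCompensatingField S U ↔ ∀ φ ψ : Chart n M, ∀ x ∈ overlap φ ψ,
      U.1 ψ (transition φ ψ x) =
        U.1 φ x + correction (S.comp ψ) (logJ φ ψ) (transition φ ψ x) := by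
  simp only [IsCompensatingField, correction, divForm, add_sub_assoc]

end Transformation

/-! ### A positive half-density, and half-densities with prescribed local coefficients. -/

section TestDensities

open Filter Topology

variable {n : ℕ} {M : Type*} [TopologicalSpace M] [ChartedSpace (Coord n) M]
  {φ ψ : Chart n M} {x : Coord n}

lemma SymTensor.contDiffAt (S : SymTensor n M) (hx : x ∈ φ.1.target) (a b : Fin n) :
    ContDiffAt ℝ ∞ (S.comp φ a b) x :=
  (S.smooth φ a b).contDiffAt hx

lemma contDiffAt_halfDensity (s : HalfDensity n M) (hx : x ∈ φ.1.target) :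
    ContDiffAt ℝ ∞ (s.1 φ) x :=
  (s.2.1 φ).contDiffAt hx

lemma contDiffAt_comp_symm {G : M → ℝ} (hx : x ∈ φ.1.target)
    (hG : ContMDiffAt 𝓘(ℝ, Coord n) 𝓘(ℝ, ℝ) ∞ G (φ.1.symm x)) :
    ContDiffAt ℝ ∞ (fun y => G (φ.1.symm y)) x := by
  have h := (contMDiffOn_symm_of_mem_maximalAtlas φ.2).contMDiffAt (φ.1.open_target.mem_nhds hx)
  exact (hG.comp x h).contDiffAt

lemma contMDiffAt_comp_chart {f : Coord n → ℝ} {m : M} (hm : m ∈ φ.1.source)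
    (hf : ContDiffAt ℝ ∞ f (φ.1 m)) :
    ContMDiffAt 𝓘(ℝ, Coord n) 𝓘(ℝ, ℝ) ∞ (fun q => f (φ.1 q)) m := by
  have h := (contMDiffOn_of_mem_maximalAtlas φ.2).contMDiffAt (φ.1.open_source.mem_nhds hm)
  exact hf.contMDiffAt.comp m h

/-- The half-density given by a formula in every coordinate system. -/
noncomputable def HalfDensity.ofFormula (u : Chart n M → Coord n → ℝ)
    (hu : ∀ φ, ∀ x ∈ φ.1.target, ContDiffAt ℝ ∞ (u φ) x)
    (hu' : ∀ φ ψ, ∀ x ∈ overlap φ ψ,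
      u φ x = u ψ (transition φ ψ x) * Real.sqrt |jacobian φ ψ x|) : HalfDensity n M :=
  ⟨fun φ => φ.1.target.indicator (u φ), fun φ => isLocalFunction_indicator (hu φ),
    fun φ ψ x hx => by
      beta_reduce
      rw [Set.indicator_of_mem (mem_overlap.1 hx).1, Set.indicator_of_mem (transition_mem_target hx),
        hu' φ ψ x hx]⟩

lemma HalfDensity.ofFormula_apply {u : Chart n M → Coord n → ℝ}
    (hu : ∀ φ, ∀ x ∈ φ.1.target, ContDiffAt ℝ ∞ (u φ) x)
    (hu' : ∀ φ ψ, ∀ x ∈ overlap φ ψ,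
      u φ x = u ψ (transition φ ψ x) * Real.sqrt |jacobian φ ψ x|) (hx : x ∈ φ.1.target) :
    (HalfDensity.ofFormula u hu hu').1 φ x = u φ x :=
  Set.indicator_of_mem hx (u φ)

/-- The product of a smooth function and a half-density. -/
noncomputable def mulFun (F : M → ℝ) (hF : ContMDiff 𝓘(ℝ, Coord n) 𝓘(ℝ, ℝ) ∞ F)
    (s : HalfDensity n M) : HalfDensity n M :=
  HalfDensity.ofFormula (fun φ x => F (φ.1.symm x) * s.1 φ x)
    (fun _ _ hx => (contDiffAt_comp_symm hx hF.contMDiffAt).mul (contDiffAt_halfDensity s hx))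
    (fun φ ψ x hx => by rw [symm_transition hx, s.2.2 φ ψ x hx, mul_assoc])

lemma mulFun_apply {F : M → ℝ} (hF : ContMDiff 𝓘(ℝ, Coord n) 𝓘(ℝ, ℝ) ∞ F) (s : HalfDensity n M)
    (hx : x ∈ φ.1.target) : (mulFun F hF s).1 φ x = F (φ.1.symm x) * s.1 φ x :=
  HalfDensity.ofFormula_apply _ _ hx

lemma HalfDensity.eq_zero_iff (s : HalfDensity n M) {m : M} (hφ : m ∈ φ.1.source)
    (hψ : m ∈ ψ.1.source) : s.1 φ (φ.1 m) = 0 ↔ s.1 ψ (ψ.1 m) = 0 := by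
  have hx : φ.1 m ∈ overlap φ ψ :=
    mem_overlap.2 ⟨φ.1.map_source hφ, by rwa [φ.1.left_inv hφ]⟩
  have h : transition φ ψ (φ.1 m) = ψ.1 m := by rw [transition, φ.1.left_inv hφ]
  rw [s.2.2 φ ψ _ hx, h]
  simp [(sqrt_abs_jacobian_pos hx).ne']

lemma HalfDensity.ext {s t : HalfDensity n M} (h : ∀ φ : Chart n M, ∀ x ∈ φ.1.target,
    s.1 φ x = t.1 φ x) : s = t :=
  Subtype.ext <| funext fun φ => (s.2.1 φ).ext (t.2.1 φ) (h φ)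

/-- The half-density `s` vanishes outside of the set `K`. -/
def VanishesOutside (s : HalfDensity n M) (K : Set M) : Prop :=
  ∀ (φ : Chart n M), ∀ x ∈ φ.1.target, φ.1.symm x ∉ K → s.1 φ x = 0

lemma VanishesOutside.eventuallyEq {s : HalfDensity n M} {K : Set M} (hs : VanishesOutside s K)
    (hK : IsClosed K) (hx : x ∈ φ.1.target) (hxK : φ.1.symm x ∉ K) :
    s.1 φ =ᶠ[𝓝 x] fun _ => 0 := by
  filter_upwards [φ.1.open_target.mem_nhds hx,
    (φ.1.continuousAt_symm hx).eventually (hK.isOpen_compl.mem_nhds hxK)] with y hy hy'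
  exact hs φ y hy hy'

lemma exists_bump (hx : x ∈ φ.1.target) : ∃ χ : Coord n → ℝ, ContDiff ℝ ∞ χ ∧
    HasCompactSupport χ ∧ tsupport χ ⊆ φ.1.target ∧ χ =ᶠ[𝓝 x] fun _ => 1 := by
  obtain ⟨r, hr, hrs⟩ := Metric.nhds_basis_closedBall.mem_iff.1 (φ.1.open_target.mem_nhds hx)
  let χ : ContDiffBump x := ⟨r / 2, r, half_pos hr, half_lt_self hr⟩
  exact ⟨χ, χ.contDiff, χ.hasCompactSupport, by rwa [χ.tsupport_eq], χ.eventuallyEq_one⟩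

variable [IsManifold 𝓘(ℝ, Coord n) ∞ M] [T2Space M] [SigmaCompactSpace M]

/-- There is an everywhere positive half-density. -/
lemma exists_pos_halfDensity :
    ∃ σ : HalfDensity n M, ∀ φ : Chart n M, ∀ x ∈ φ.1.target, 0 < σ.1 φ x := by
  obtain ⟨ρ, hρ⟩ :=
    SmoothPartitionOfUnity.exists_isSubordinate_chartAt_source 𝓘(ℝ, Coord n) M
  have hsrc : ∀ p m, ρ p m ≠ 0 → m ∈ (preferredChart n p).1.source := fun p m h =>
    hρ p (subset_tsupport _ h)
  have hfin : ∀ (φ : Chart n M) (x : Coord n), (Function.support fun p =>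
      ρ p (φ.1.symm x) * Real.sqrt |jacobian φ (preferredChart n p) x|).Finite := fun φ x =>
    (ρ.locallyFinite.point_finite (φ.1.symm x)).subset fun p hp => left_ne_zero_of_mul hp
  -- The half-densities `√|Dx|` of the preferred charts, glued by the partition of unity. Off the
  -- domain of the chart at `p` the Jacobian is meaningless, but there `ρ p` is zero.
  refine ⟨⟨fun φ => φ.1.target.indicator fun x =>
    ∑ᶠ p, ρ p (φ.1.symm x) * Real.sqrt |jacobian φ (preferredChart n p) x|, fun φ =>
    isLocalFunction_indicator fun x hx => ?_, fun φ ψ x hx => ?_⟩, fun φ x hx => ?_⟩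
  · have h : ContMDiffAt 𝓘(ℝ, Coord n) 𝓘(ℝ, ℝ) ∞ (fun m => ∑ᶠ p, ρ p m •
        Real.sqrt |jacobian φ (preferredChart n p) (φ.1 m)|) (φ.1.symm x) := by
      refine ρ.contMDiffAt_finsum fun p hp => ?_
      refine contMDiffAt_comp_chart
        (f := fun y => Real.sqrt |jacobian φ (preferredChart n p) y|) (φ.1.map_target hx) ?_
      rw [φ.1.right_inv hx]
      exact contDiffAt_sqrt_abs_jacobian (mem_overlap.2 ⟨hx, hρ p hp⟩)
    refine (contDiffAt_comp_symm hx h).congr_of_eventuallyEq ?_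
    filter_upwards [φ.1.open_target.mem_nhds hx] with y hy
    simp only [smul_eq_mul, φ.1.right_inv hy]
  · simp only
    rw [Set.indicator_of_mem (mem_overlap.1 hx).1, Set.indicator_of_mem (transition_mem_target hx),
      finsum_mul]
    refine finsum_congr fun p => ?_
    rw [symm_transition hx]
    by_cases h : ρ p (φ.1.symm x) = 0
    · simp [h]
    · rw [jacobian_mul hx (hsrc p _ h), abs_mul, Real.sqrt_mul (abs_nonneg _), mul_assoc]
  · simp only
    rw [Set.indicator_of_mem hx]
    obtain ⟨p, hp⟩ := ρ.exists_pos_of_mem (Set.mem_univ (φ.1.symm x))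
    refine finsum_pos (fun q => mul_nonneg (ρ.nonneg q _) (Real.sqrt_nonneg _)) ⟨p, ?_⟩ (hfin _ _)
    exact mul_pos hp (sqrt_abs_jacobian_pos (mem_overlap.2 ⟨hx, hsrc p _ hp.ne'⟩))

/-- A smooth function with compact support in a chart defines a half-density. -/
lemma exists_halfDensity_eq {f : Coord n → ℝ} (hf : ContDiff ℝ ∞ f) (hc : HasCompactSupport f)
    (hsub : tsupport f ⊆ φ.1.target) :
    ∃ s : HalfDensity n M, (∀ x ∈ φ.1.target, s.1 φ x = f x) ∧
      VanishesOutside s (φ.1.symm '' tsupport f) := by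
  classical
  obtain ⟨σ, hσ⟩ := exists_pos_halfDensity (n := n) (M := M)
  have hK : IsCompact (φ.1.symm '' tsupport f) :=
    hc.image_of_continuousOn (φ.1.continuousOn_symm.mono hsub)
  have hKs : φ.1.symm '' tsupport f ⊆ φ.1.source := by
    rintro _ ⟨x, hx, rfl⟩
    exact φ.1.map_target (hsub hx)
  -- Dividing by the positive `σ` turns `f` into a scalar function, which extends smoothly by zero
  -- since its support lies in a compact, hence closed, subset of the chart domain.
  let F : M → ℝ := φ.1.source.indicator fun m => f (φ.1 m) / σ.1 φ (φ.1 m)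
  have hF0 : ∀ m, m ∉ φ.1.symm '' tsupport f → F m = 0 := fun m hm => by
    by_cases hms : m ∈ φ.1.source
    · simp only [F]
      rw [Set.indicator_of_mem hms, image_eq_zero_of_notMem_tsupport (f := f)
        fun h => hm ⟨_, h, φ.1.left_inv hms⟩, zero_div]
    · exact Set.indicator_of_notMem hms _
  have hsupp : tsupport F ⊆ φ.1.symm '' tsupport f :=
    closure_minimal (fun m hm => by_contra fun h => hm (hF0 m h)) hK.isClosed
  have hFs : ContMDiff 𝓘(ℝ, Coord n) 𝓘(ℝ, ℝ) ∞ F := by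
    refine contMDiff_of_tsupport fun m hm => ?_
    have hms := hKs (hsupp hm)
    have h1 : ContDiffAt ℝ ∞ (fun y => f y / σ.1 φ y) (φ.1 m) :=
      hf.contDiffAt.div ((σ.2.1 φ).contDiffAt (φ.1.map_source hms))
        (hσ φ _ (φ.1.map_source hms)).ne'
    refine (contMDiffAt_comp_chart hms h1).congr_of_eventuallyEq ?_
    filter_upwards [φ.1.open_source.mem_nhds hms] with q hq using Set.indicator_of_mem hq _
  refine ⟨mulFun F hFs σ, fun x hx => ?_, fun ψ x hx hxK => ?_⟩
  · rw [mulFun_apply _ _ hx]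
    simp only [F]
    rw [Set.indicator_of_mem (φ.1.map_target hx), φ.1.right_inv hx,
      div_mul_cancel₀ _ (hσ φ x hx).ne']
  · rw [mulFun_apply _ _ hx, hF0 _ hxK, zero_mul]

/-- Half-densities with prescribed germ at a point, in given coordinates. -/
lemma exists_halfDensity_germ {f : Coord n → ℝ} (hf : ContDiff ℝ ∞ f) (hx : x ∈ φ.1.target) :
    ∃ s : HalfDensity n M, s.1 φ =ᶠ[𝓝 x] f := by
  obtain ⟨χ, h1, h2, h3, h4⟩ := exists_bump hx
  obtain ⟨s, hs, -⟩ := exists_halfDensity_eq (φ := φ) (h1.mul hf) h2.mul_right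
    ((tsupport_mul_subset_left (f := χ) (g := f)).trans h3)
  refine ⟨s, ?_⟩
  filter_upwards [φ.1.open_target.mem_nhds hx, h4] with y hy hy'
  rw [hs y hy, hy', one_mul]

end TestDensities

/-! ### Gluing the local formulas; uniqueness and existence of the potential. -/

section Operators

open Filter Topology

variable {n : ℕ} {M : Type*} [TopologicalSpace M] [ChartedSpace (Coord n) M]
  {φ ψ : Chart n M} {x : Coord n}

lemma hasLocalForm_iff {D : HalfDensity n M →ₗ[ℝ] HalfDensity n M} {S : SymTensor n M}
    {U : ChartFunctions n M} : HasLocalForm D S U ↔ ∀ (φ : Chart n M) (s : HalfDensity n M),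
      ∀ x ∈ φ.1.target, (D s).1 φ x =
        (1 / 2) * (divForm (S.comp φ) (s.1 φ) x + U.1 φ x * s.1 φ x) := by
  refine forall_congr' fun φ => forall_congr' fun s => forall₂_congr fun x hx => ?_
  rw [divForm_eq (fun a b => S.contDiffAt hx a b) (contDiffAt_halfDensity s hx)]
  simp only [mul_add, Finset.mul_sum, Finset.sum_mul, mul_assoc]

lemma divForm_add {S : Fin n → Fin n → Coord n → ℝ} {u v : Coord n → ℝ}
    (hS : ∀ a b, ContDiffAt ℝ ∞ (S a b) x) (hu : ContDiffAt ℝ ∞ u x) (hv : ContDiffAt ℝ ∞ v x) :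
    divForm S (fun y => u y + v y) x = divForm S u x + divForm S v x := by
  simp only [divForm, ← Finset.sum_add_distrib]
  refine Finset.sum_congr rfl fun a _ => ?_
  rw [← pd_add a (contDiffAt_flux hS hu a).differentiableAt_infty
    (contDiffAt_flux hS hv a).differentiableAt_infty]
  refine pd_congr ?_ a
  filter_upwards [hu.eventually_differentiableAt, hv.eventually_differentiableAt] with y h1 h2
  simp only [← Finset.sum_add_distrib, ← mul_add]
  exact Finset.sum_congr rfl fun b _ => by rw [pd_add b h1 h2]

lemma divForm_const_mul {S : Fin n → Fin n → Coord n → ℝ} {u : Coord n → ℝ} (c : ℝ)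
    (hS : ∀ a b, ContDiffAt ℝ ∞ (S a b) x) (hu : ContDiffAt ℝ ∞ u x) :
    divForm S (fun y => c * u y) x = c * divForm S u x := by
  simp only [divForm, Finset.mul_sum]
  refine Finset.sum_congr rfl fun a _ => ?_
  rw [← pd_const_mul a c (contDiffAt_flux hS hu a).differentiableAt_infty]
  refine pd_congr ?_ a
  filter_upwards [hu.eventually_differentiableAt] with y h1
  simp only [Finset.mul_sum]
  exact Finset.sum_congr rfl fun b _ => by rw [pd_const_mul b c h1]; ring

/-- The operator `1/2 (∂_a S^{ab} ∂_b + U)` defined by a tensor field and a compensating field. -/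
noncomputable def operatorOf (S : SymTensor n M) (U : ChartFunctions n M)
    (hU : IsCompensatingField S U) : HalfDensity n M →ₗ[ℝ] HalfDensity n M where
  toFun s := HalfDensity.ofFormula
    (fun φ x => (1 / 2) * (divForm (S.comp φ) (s.1 φ) x + U.1 φ x * s.1 φ x))
    (fun φ x hx => contDiffAt_const.mul
      ((contDiffAt_divForm (fun a b => S.contDiffAt hx a b) (contDiffAt_halfDensity s hx)).add
        (((U.2 φ).contDiffAt hx).mul (contDiffAt_halfDensity s hx))))
    (fun φ ψ x hx => by
      -- The same correction arises from the divergence form on one side and from `U` on the other.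
      rw [divForm_transform S s hx, (isCompensatingField_iff S U).1 hU φ ψ x hx, s.2.2 φ ψ x hx]
      ring)
  map_add' s t := HalfDensity.ext fun φ x hx => by
    have h := divForm_add (fun a b => S.contDiffAt hx a b) (contDiffAt_halfDensity s hx)
      (contDiffAt_halfDensity t hx)
    change _ = (HalfDensity.ofFormula _ _ _).1 φ x + (HalfDensity.ofFormula _ _ _).1 φ x
    rw [HalfDensity.ofFormula_apply _ _ hx, HalfDensity.ofFormula_apply _ _ hx,
      HalfDensity.ofFormula_apply _ _ hx]
    change (1 / 2) * (divForm _ (fun y => s.1 φ y + t.1 φ y) x + U.1 φ x * (s.1 φ x + t.1 φ x)) = _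
    rw [h]
    ring
  map_smul' c s := HalfDensity.ext fun φ x hx => by
    have h := divForm_const_mul c (fun a b => S.contDiffAt hx a b) (contDiffAt_halfDensity s hx)
    change _ = c * (HalfDensity.ofFormula _ _ _).1 φ x
    rw [HalfDensity.ofFormula_apply _ _ hx, HalfDensity.ofFormula_apply _ _ hx]
    change (1 / 2) * (divForm _ (fun y => c * s.1 φ y) x + U.1 φ x * (c * s.1 φ x)) = _
    rw [h]
    ring

lemma operatorOf_hasLocalForm (S : SymTensor n M) (U : ChartFunctions n M)
    (hU : IsCompensatingField S U) : HasLocalForm (operatorOf S U hU) S U :=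
  hasLocalForm_iff.2 fun φ s _ hx => Set.indicator_of_mem hx
    fun x => (1 / 2) * (divForm (S.comp φ) (s.1 φ) x + U.1 φ x * s.1 φ x)

lemma HasLocalForm.hasPrincipalSymbol {D : HalfDensity n M →ₗ[ℝ] HalfDensity n M}
    {S : SymTensor n M} {U : ChartFunctions n M} (h : HasLocalForm D S U) :
    HasPrincipalSymbol D S := by
  intro φ
  -- The derivative of a function extended by zero need not vanish at boundary points of the target,
  -- so this coefficient has to be cut off again.
  refine ⟨fun a => φ.1.target.indicator fun x => (1 / 2) * ∑ b, pd b (S.comp φ b a) x,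
    fun x => (1 / 2) * U.1 φ x, fun a => isLocalFunction_indicator fun x hx =>
      contDiffAt_const.mul (ContDiffAt.sum fun b _ => (S.contDiffAt hx b a).pd b),
    ⟨contDiffOn_const.mul (U.2 φ).1, fun x hx => by simp only [(U.2 φ).2 x hx, mul_zero]⟩,
    fun s x hx => ?_⟩
  rw [h φ s x hx]
  simp only [Set.indicator_of_mem hx]

lemma HasPrincipalSymbol.isSecondOrder {D : HalfDensity n M →ₗ[ℝ] HalfDensity n M}
    {S : SymTensor n M} (h : HasPrincipalSymbol D S) : IsSecondOrder D := by
  intro φ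
  obtain ⟨B, C, hB, hC, hD⟩ := h φ
  exact ⟨_, B, C, fun a b => ⟨contDiffOn_const.mul (S.smooth φ a b).1,
    fun x hx => by simp only [(S.smooth φ a b).2 x hx, mul_zero]⟩, hB, hC, hD⟩

lemma HasLocalForm.operator_unique {D D' : HalfDensity n M →ₗ[ℝ] HalfDensity n M}
    {S : SymTensor n M} {U : ChartFunctions n M} (h : HasLocalForm D S U)
    (h' : HasLocalForm D' S U) : D = D' :=
  LinearMap.ext fun s => HalfDensity.ext fun φ x hx => by rw [h φ s x hx, h' φ s x hx]

variable [IsManifold 𝓘(ℝ, Coord n) ∞ M] [T2Space M] [SigmaCompactSpace M]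

/-- On a positive half-density `σ` the term `U σ` is determined by `D σ` and `S`, and it can be
divided by `σ`. -/
lemma HasLocalForm.potential_unique {D : HalfDensity n M →ₗ[ℝ] HalfDensity n M}
    {S : SymTensor n M} {U U' : ChartFunctions n M} (h : HasLocalForm D S U)
    (h' : HasLocalForm D S U') : U = U' := by
  obtain ⟨σ, hσ⟩ := exists_pos_halfDensity (n := n) (M := M)
  refine Subtype.ext (funext fun φ => (U.2 φ).ext (U'.2 φ) fun x hx => ?_)
  have h1 := hasLocalForm_iff.1 h φ σ x hx
  rw [hasLocalForm_iff.1 h' φ σ x hx] at h1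
  refine mul_right_cancel₀ (hσ φ x hx).ne' ?_
  linarith

/-- Since `D σ` is again a half-density, its two coordinate expressions agree up to `√|J|`. By
`divForm_transform`, cancelling the positive factor leaves the transformation law of `U`. -/
lemma HasLocalForm.isCompensatingField {D : HalfDensity n M →ₗ[ℝ] HalfDensity n M}
    {S : SymTensor n M} {U : ChartFunctions n M} (h : HasLocalForm D S U) :
    IsCompensatingField S U := by
  obtain ⟨σ, hσ⟩ := exists_pos_halfDensity (n := n) (M := M)
  rw [isCompensatingField_iff]
  intro φ ψ x hx
  have h1 := hasLocalForm_iff.1 h φ σ x (mem_overlap.1 hx).1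
  rw [(D σ).2.2 φ ψ x hx, hasLocalForm_iff.1 h ψ σ _ (transition_mem_target hx),
    divForm_transform S σ hx, σ.2.2 φ ψ x hx] at h1
  have h2 := (sqrt_abs_jacobian_pos hx).ne'
  have h3 := (hσ ψ _ (transition_mem_target hx)).ne'
  refine mul_right_cancel₀ (mul_ne_zero h2 h3) ?_
  linear_combination 2 * h1

/-- Compensating fields exist: there is one whose operator annihilates a given positive
half-density. -/
lemma exists_isCompensatingField (S : SymTensor n M) :
    ∃ U : ChartFunctions n M, IsCompensatingField S U := by
  obtain ⟨σ, hσ⟩ := exists_pos_halfDensity (n := n) (M := M)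
  refine ⟨⟨fun φ => φ.1.target.indicator fun x => -(divForm (S.comp φ) (σ.1 φ) x / σ.1 φ x),
    fun φ => isLocalFunction_indicator fun x hx => ((contDiffAt_divForm
      (fun a b => S.contDiffAt hx a b) (contDiffAt_halfDensity σ hx)).div (contDiffAt_halfDensity σ hx)
        (hσ φ x hx).ne').neg⟩, ?_⟩
  rw [isCompensatingField_iff]
  intro φ ψ x hx
  have h2 := (sqrt_abs_jacobian_pos hx).ne'
  have h3 := (hσ ψ _ (transition_mem_target hx)).ne'
  simp only
  rw [Set.indicator_of_mem (mem_overlap.1 hx).1, Set.indicator_of_mem (transition_mem_target hx),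
    divForm_transform S σ hx, σ.2.2 φ ψ x hx]
  field_simp
  ring

end Operators

/-! ### Existence and uniqueness of the principal symbol. -/

section PrincipalSymbol

open Filter Topology

variable {n : ℕ} {M : Type*} [TopologicalSpace M] [ChartedSpace (Coord n) M]
  {φ ψ : Chart n M} {x : Coord n}

/-- The action of a second order operator on a product with two factors vanishing at a point. -/
lemma ActsAs.apply_mul {D : HalfDensity n M →ₗ[ℝ] HalfDensity n M}
    {A : Fin n → Fin n → Coord n → ℝ} {B : Fin n → Coord n → ℝ} {C : Coord n → ℝ}
    (hD : ActsAs D φ A B C) (hx : x ∈ φ.1.target) {s : HalfDensity n M} {f g h : Coord n → ℝ}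
    (hs : s.1 φ =ᶠ[𝓝 x] fun y => f y * (g y * h y)) (hf : ContDiffAt ℝ ∞ f x)
    (hg : ContDiffAt ℝ ∞ g x) (hh : ContDiffAt ℝ ∞ h x) (hf0 : f x = 0) (hg0 : g x = 0) :
    (D s).1 φ x = h x * ∑ a, ∑ b, A a b x * (pd a f x * pd b g x + pd b f x * pd a g x) := by
  have hgh : ContDiffAt ℝ ∞ (fun y => g y * h y) x := hg.mul hh
  have h1 : ∀ a, pd a (fun y => g y * h y) x = pd a g x * h x := fun a => by
    rw [pd_mul a hg.differentiableAt_infty hh.differentiableAt_infty, hg0]; ring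
  have h2 : ∀ a, pd a (s.1 φ) x = 0 := fun a => by
    rw [pd_congr hs, pd_mul a hf.differentiableAt_infty hgh.differentiableAt_infty, hg0, hf0]; ring
  have h3 : ∀ a b, pd b (pd a (s.1 φ)) x =
      h x * (pd a f x * pd b g x + pd b f x * pd a g x) := fun a b => by
    rw [pd_congr (pd_eventuallyEq hs a), pd_pd_mul a b hf hgh, h1, h1, hg0, hf0]; ring
  rw [hD s x hx, hs.eq_of_nhds, hf0]
  simp only [h2, h3, Finset.mul_sum, mul_zero, zero_mul, Finset.sum_const_zero, add_zero]
  exact Finset.sum_congr rfl fun a _ => Finset.sum_congr rfl fun b _ => by ring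

lemma sum_kronecker (A : Fin n → Fin n → ℝ) (c d : Fin n) :
    ∑ a, ∑ b, A a b * ((if a = c then (1 : ℝ) else 0) * (if b = d then 1 else 0)
      + (if b = c then 1 else 0) * (if a = d then 1 else 0)) = A c d + A d c := by
  simp [mul_add, Finset.sum_add_distrib]

lemma contDiff_coord_sub (c : Fin n) (t : ℝ) : ContDiff ℝ ∞ (fun y : Coord n => y c - t) :=
  (EuclideanSpace.proj c : Coord n →L[ℝ] ℝ).contDiff.sub contDiff_const

variable [IsManifold 𝓘(ℝ, Coord n) ∞ M] [T2Space M] [SigmaCompactSpace M]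

/-- A probe for the symmetrised second order coefficient: a double zero at `x` kills all lower order
terms. One half-density serves for all operators. -/
lemma exists_halfDensity_quadratic (hx : x ∈ φ.1.target) (c d : Fin n) :
    ∃ s : HalfDensity n M, s.1 φ =ᶠ[𝓝 x] (fun y => (y c - x c) * ((y d - x d) * 1)) ∧
      ∀ (D : HalfDensity n M →ₗ[ℝ] HalfDensity n M) A B C, ActsAs D φ A B C →
        (D s).1 φ x = A c d x + A d c x := by
  obtain ⟨s, hs⟩ := exists_halfDensity_germ (φ := φ)
    ((contDiff_coord_sub c (x c)).mul ((contDiff_coord_sub d (x d)).mul contDiff_const)) hx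
  refine ⟨s, hs, fun D A B C hD => ?_⟩
  rw [hD.apply_mul hx hs (contDiff_coord_sub c _).contDiffAt (contDiff_coord_sub d _).contDiffAt
    contDiffAt_const (sub_self _) (sub_self _)]
  simp only [pd_coord, one_mul]
  exact sum_kronecker (fun a b => A a b x) c d

lemma HasPrincipalSymbol.unique {D : HalfDensity n M →ₗ[ℝ] HalfDensity n M} {S S' : SymTensor n M}
    (h : HasPrincipalSymbol D S) (h' : HasPrincipalSymbol D S') : S = S' := by
  have hcomp : S.comp = S'.comp := by
    funext φ c d
    refine (S.smooth φ c d).ext (S'.smooth φ c d) fun x hx => ?_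
    obtain ⟨s, -, hs⟩ := exists_halfDensity_quadratic hx c d
    obtain ⟨B, C, -, -, h1⟩ := h φ
    obtain ⟨B', C', -, -, h2⟩ := h' φ
    have h3 := hs D _ B C h1
    rw [hs D _ B' C' h2, S.symmetric φ d c, S'.symmetric φ d c] at h3
    linarith
  cases S
  cases S'
  simpa using hcomp

/-- The prefactor `1/2` forces `S^{ab} = A^{ab} + A^{ba}`. For the tensor law, the quadratic probe
in the chart `ψ` is viewed in `φ`: it is a product of two functions vanishing at the point, whose
gradients are rows of the Jacobi matrix, times `√|J|`. This weight cancels because `D s` carries it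
too. -/
lemma IsSecondOrder.exists_hasPrincipalSymbol {D : HalfDensity n M →ₗ[ℝ] HalfDensity n M}
    (h : IsSecondOrder D) : ∃ S : SymTensor n M, HasPrincipalSymbol D S := by
  choose A B C hA hB hC hD using h
  refine ⟨⟨fun φ a b x => A φ a b x + A φ b a x, fun φ a b => ⟨(hA φ a b).1.add (hA φ b a).1,
    fun x hx => by simp only [(hA φ a b).2 x hx, (hA φ b a).2 x hx, add_zero]⟩,
    fun φ a b => by funext x; exact add_comm _ _, fun φ ψ x hx a' b' => ?_⟩,
    fun φ => ⟨B φ, C φ, hB φ, hC φ, fun s x hx => ?_⟩⟩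
  · obtain ⟨s, hs, hDs⟩ := exists_halfDensity_quadratic (transition_mem_target hx) a' b'
    have h1 := hDs D _ _ _ (hD ψ)
    set T := transition φ ψ with hT
    have hTs : ContDiffAt ℝ ∞ T x := contDiffAt_transition hx
    have hcoord : ∀ c : Fin n, ContDiffAt ℝ ∞ (fun y => T y c - T x c) x := fun c =>
      (contDiff_coord_sub c (T x c)).contDiffAt.comp x hTs
    have hpd : ∀ c a : Fin n, pd a (fun y => T y c - T x c) x = jacobiEntry φ ψ x c a :=
      fun c a => by
        rw [pd_comp (f := fun y : Coord n => y c - T x c) hTs.differentiableAt_infty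
          (contDiff_coord_sub c _).contDiffAt.differentiableAt_infty]
        simp [pd_coord, jacobiEntry, hT]
    have hs' : s.1 φ =ᶠ[𝓝 x] fun y => (T y a' - T x a') * ((T y b' - T x b')
        * Real.sqrt |jacobian φ ψ y|) := by
      filter_upwards [overlap_mem_nhds hx, hTs.continuousAt.eventually hs] with y hy hy'
      rw [s.2.2 φ ψ y hy, hy']
      ring
    have h2 := (hD φ).apply_mul (mem_overlap.1 hx).1 hs' (hcoord a') (hcoord b')
      (contDiffAt_sqrt_abs_jacobian hx) (sub_self _) (sub_self _)
    rw [(D s).2.2 φ ψ x hx, ← hT, h1, mul_comm] at h2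
    rw [mul_left_cancel₀ (sqrt_abs_jacobian_pos hx).ne' h2]
    simp only [hpd, mul_add, add_mul, Finset.sum_add_distrib]
    congr 1
    · exact Finset.sum_congr rfl fun a _ => Finset.sum_congr rfl fun b _ => by ring
    · rw [Finset.sum_comm]
      exact Finset.sum_congr rfl fun a _ => Finset.sum_congr rfl fun b _ => by ring
  · rw [hD φ s x hx]
    congr 2
    have hsymm : ∑ a, ∑ b, A φ b a x * pd b (pd a (s.1 φ)) x =
        ∑ a, ∑ b, A φ a b x * pd b (pd a (s.1 φ)) x := by
      rw [Finset.sum_comm]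
      exact Finset.sum_congr rfl fun a _ => Finset.sum_congr rfl fun b _ => by
        rw [pd_pd_comm a b (contDiffAt_halfDensity s hx)]
    simp only [mul_add, add_mul, Finset.sum_add_distrib, mul_assoc, ← Finset.mul_sum, hsymm]
    ring

end PrincipalSymbol

/-! ### The affine space of compensating fields. -/

section Torsor

variable {n : ℕ} {M : Type*} [TopologicalSpace M] [ChartedSpace (Coord n) M]
  {S : SymTensor n M}

/-- The difference of two compensating fields does not depend on the coordinates. -/
lemma CompensatingField.sub_eq (U V : CompensatingField S) {φ ψ : Chart n M} {m : M}
    (hφ : m ∈ φ.1.source) (hψ : m ∈ ψ.1.source) :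
    U.1.1 φ (φ.1 m) - V.1.1 φ (φ.1 m) = U.1.1 ψ (ψ.1 m) - V.1.1 ψ (ψ.1 m) := by
  have hx : φ.1 m ∈ overlap φ ψ :=
    mem_overlap.2 ⟨φ.1.map_source hφ, by rwa [φ.1.left_inv hφ]⟩
  have hU := (isCompensatingField_iff S U.1).1 U.2 φ ψ _ hx
  have hV := (isCompensatingField_iff S V.1).1 V.2 φ ψ _ hx
  have h : transition φ ψ (φ.1 m) = ψ.1 m := by rw [transition, φ.1.left_inv hφ]
  rw [h] at hU hV
  rw [hU, hV]
  ring

lemma CompensatingField.ext {U V : CompensatingField S}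
    (h : ∀ φ : Chart n M, ∀ x ∈ φ.1.target, U.1.1 φ x = V.1.1 φ x) : U = V :=
  Subtype.ext <| Subtype.ext <| funext fun φ => (U.1.2 φ).ext (V.1.2 φ) (h φ)

/-- A smooth function acts on compensating fields by addition. -/
noncomputable def CompensatingField.add (F : C^∞⟮𝓘(ℝ, Coord n), M; 𝓘(ℝ, ℝ), ℝ⟯)
    (U : CompensatingField S) : CompensatingField S :=
  ⟨⟨fun φ => φ.1.target.indicator fun x => U.1.1 φ x + F (φ.1.symm x), fun φ =>
    isLocalFunction_indicator fun _ hx =>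
      ((U.1.2 φ).contDiffAt hx).add (contDiffAt_comp_symm hx F.contMDiff.contMDiffAt)⟩, by
    rw [isCompensatingField_iff]
    intro φ ψ x hx
    simp only
    rw [Set.indicator_of_mem (mem_overlap.1 hx).1, Set.indicator_of_mem (transition_mem_target hx),
      symm_transition hx, (isCompensatingField_iff S U.1).1 U.2 φ ψ x hx]
    ring⟩

lemma CompensatingField.add_apply (F : C^∞⟮𝓘(ℝ, Coord n), M; 𝓘(ℝ, ℝ), ℝ⟯)
    (U : CompensatingField S) {φ : Chart n M} {x : Coord n} (hx : x ∈ φ.1.target) :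
    (CompensatingField.add F U).1.1 φ x = U.1.1 φ x + F (φ.1.symm x) :=
  Set.indicator_of_mem hx fun x => U.1.1 φ x + F (φ.1.symm x)

variable [IsManifold 𝓘(ℝ, Coord n) ∞ M]

lemma mem_preferredChart_source (m : M) : m ∈ (preferredChart n m).1.source :=
  mem_chart_source (Coord n) m

/-- The difference of two compensating fields, a smooth function. -/
noncomputable def CompensatingField.diff (U V : CompensatingField S) :
    C^∞⟮𝓘(ℝ, Coord n), M; 𝓘(ℝ, ℝ), ℝ⟯ :=
  ⟨fun m => U.1.1 (preferredChart n m) ((preferredChart n m).1 m)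
    - V.1.1 (preferredChart n m) ((preferredChart n m).1 m), fun m => by
    have hm := mem_preferredChart_source (n := n) m
    -- The preferred chart jumps from point to point; near `m` it may be frozen to the chart at `m`,
    -- because the difference does not depend on the chart.
    refine (contMDiffAt_comp_chart (φ := preferredChart n m) (f := fun x =>
      U.1.1 (preferredChart n m) x - V.1.1 (preferredChart n m) x) hm
      (((U.1.2 _).contDiffAt ((preferredChart n m).1.map_source hm)).sub
        ((V.1.2 _).contDiffAt ((preferredChart n m).1.map_source hm)))).congr_of_eventuallyEq ?_
    filter_upwards [(preferredChart n m).1.open_source.mem_nhds hm] with q hq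
    exact CompensatingField.sub_eq U V (mem_preferredChart_source q) hq⟩

lemma CompensatingField.diff_apply (U V : CompensatingField S) {φ : Chart n M} {m : M}
    (hm : m ∈ φ.1.source) :
    CompensatingField.diff U V m = U.1.1 φ (φ.1 m) - V.1.1 φ (φ.1 m) :=
  CompensatingField.sub_eq U V (mem_preferredChart_source m) hm

variable [T2Space M] [SigmaCompactSpace M]

/-- Compensating fields form an affine space over the smooth functions. -/
noncomputable abbrev compensatingTorsor (S : SymTensor n M) :
    AddTorsor C^∞⟮𝓘(ℝ, Coord n), M; 𝓘(ℝ, ℝ), ℝ⟯ (CompensatingField S) where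
  vadd := CompensatingField.add
  zero_vadd U := CompensatingField.ext fun φ x hx =>
    (CompensatingField.add_apply 0 U hx).trans (add_zero _)
  add_vadd F G U := CompensatingField.ext fun φ x hx => by
    change (CompensatingField.add (F + G) U).1.1 φ x =
      (CompensatingField.add F (CompensatingField.add G U)).1.1 φ x
    rw [CompensatingField.add_apply _ _ hx, CompensatingField.add_apply _ _ hx,
      CompensatingField.add_apply _ _ hx]
    simp only [ContMDiffMap.coe_add, Pi.add_apply]
    ring
  vsub := CompensatingField.diff
  nonempty := by
    obtain ⟨U, hU⟩ := exists_isCompensatingField S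
    exact ⟨⟨U, hU⟩⟩
  vsub_vadd' U V := CompensatingField.ext fun φ x hx => by
    change (CompensatingField.add (CompensatingField.diff U V) V).1.1 φ x = _
    rw [CompensatingField.add_apply _ _ hx, CompensatingField.diff_apply U V (φ.1.map_target hx),
      φ.1.right_inv hx]
    ring
  vadd_vsub' F U := ContMDiffMap.ext fun m => by
    have hm := mem_preferredChart_source (n := n) m
    change CompensatingField.diff (CompensatingField.add F U) U m = F m
    rw [CompensatingField.diff_apply _ _ hm,
      CompensatingField.add_apply _ _ ((preferredChart n m).1.map_source hm),
      (preferredChart n m).1.left_inv hm]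
    ring

end Torsor

/-! ### Integrals of divergences, and test functions. -/

section Integration

open Filter Topology

variable {n : ℕ} {V K : Set (Coord n)} {f : Coord n → ℝ}

lemma integrableOn_of_compact (hV : IsOpen V) (hK : IsCompact K) (hKV : K ⊆ V)
    (hf : ∀ x ∈ V, ContDiffAt ℝ ∞ f x) (hf0 : ∀ x ∈ V, x ∉ K → f x = 0) :
    IntegrableOn f V := by
  have h : IntegrableOn f K := ContinuousOn.integrableOn_compact hK
    fun x hx => (hf x (hKV hx)).continuousAt.continuousWithinAt
  exact h.of_forall_sdiff_eq_zero hV.measurableSet fun x hx => hf0 x hx.1 hx.2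

/-- Integration by parts against the constant function `1`. -/
lemma integral_pd_eq_zero {g : Coord n → ℝ} (hg : ContDiff ℝ ∞ g) (hc : HasCompactSupport g)
    (a : Fin n) : ∫ x, pd a g x = 0 := by
  have hpd : Continuous (pd a g) := (hg.continuous_fderiv (by simp)).clm_apply continuous_const
  have hpc : HasCompactSupport (pd a g) :=
    (hc.fderiv ℝ).comp_left (g := fun l : Coord n →L[ℝ] ℝ => l (EuclideanSpace.single a 1)) rfl
  have hi : Integrable (pd a g) := hpd.integrable_of_hasCompactSupport hpc
  have h := integral_mul_fderiv_eq_neg_fderiv_mul_of_integrable (μ := volume)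
    (f := fun _ : Coord n => (1 : ℝ)) (g := g) (v := EuclideanSpace.single a 1)
    (by simp) (by simp only [one_mul]; exact hi)
    (by simpa using hg.continuous.integrable_of_hasCompactSupport hc)
    (fun _ _ => by fun_prop) (fun x _ => hg.contDiffAt.differentiableAt_infty)
  simpa [pd] using h

lemma setIntegral_pd_eq_zero (hV : IsOpen V) (hK : IsCompact K) (hKV : K ⊆ V)
    (hf : ∀ x ∈ V, ContDiffAt ℝ ∞ f x) (hf0 : ∀ x ∈ V, x ∉ K → f x = 0) (a : Fin n) :
    ∫ x in V, pd a f x = 0 := by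
  -- Because `f` vanishes outside a compact subset of `V`, its extension by zero is smooth on all of
  -- `ℝⁿ`.
  set g : Coord n → ℝ := V.indicator f with hg
  have hgf : ∀ x ∈ V, g =ᶠ[𝓝 x] f := fun x hx => by
    filter_upwards [hV.mem_nhds hx] with y hy using Set.indicator_of_mem hy f
  have hg0 : ∀ x, x ∉ K → g x = 0 := fun x hx => by
    by_cases hxV : x ∈ V
    · rw [hg, Set.indicator_of_mem hxV, hf0 x hxV hx]
    · exact Set.indicator_of_notMem hxV f
  have hge : ∀ x, x ∉ K → g =ᶠ[𝓝 x] fun _ => 0 := fun x hx => by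
    filter_upwards [hK.isClosed.isOpen_compl.mem_nhds hx] with y hy using hg0 y hy
  have hgs : ContDiff ℝ ∞ g := contDiff_iff_contDiffAt.2 fun x => by
    by_cases hx : x ∈ K
    · exact (hf x (hKV hx)).congr_of_eventuallyEq (hgf x (hKV hx))
    · exact contDiffAt_const.congr_of_eventuallyEq (hge x hx)
  rw [← integral_pd_eq_zero hgs (HasCompactSupport.intro hK hg0) a,
    ← setIntegral_univ (f := fun x => pd a g x), setIntegral_eq_of_subset_of_forall_sdiff_eq_zero
      MeasurableSet.univ (Set.subset_univ V) fun x hx => ?_]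
  · exact setIntegral_congr_fun hV.measurableSet fun x hx => (pd_congr (hgf x hx) a).symm
  · rw [pd_congr (hge x fun h => hx.2 (hKV h)), pd_const]

/-- The integral of the divergence of a compactly supported vector field vanishes. -/
lemma setIntegral_sum_pd_eq_zero {X : Fin n → Coord n → ℝ} (hV : IsOpen V) (hK : IsCompact K)
    (hKV : K ⊆ V) (hX : ∀ a, ∀ x ∈ V, ContDiffAt ℝ ∞ (X a) x)
    (hX0 : ∀ a, ∀ x ∈ V, x ∉ K → X a x = 0) : ∫ x in V, ∑ a, pd a (X a) x = 0 := by
  rw [integral_finsetSum]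
  · exact Finset.sum_eq_zero fun a _ => setIntegral_pd_eq_zero hV hK hKV (hX a) (hX0 a) a
  · refine fun a _ => integrableOn_of_compact hV hK hKV (fun x hx => (hX a x hx).pd a)
      fun x hx hxK => ?_
    have h : X a =ᶠ[𝓝 x] fun _ => 0 := by
      filter_upwards [hV.mem_nhds hx, hK.isClosed.isOpen_compl.mem_nhds hxK] with y hy hy'
        using hX0 a y hy hy'
    rw [pd_congr h, pd_const]

/-- A smooth function that is orthogonal to all test functions vanishes. -/
lemma eq_zero_of_integral_mul_eq_zero (hV : IsOpen V) (hf : ∀ x ∈ V, ContDiffAt ℝ ∞ f x)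
    (h : ∀ g : Coord n → ℝ, ContDiff ℝ ∞ g → HasCompactSupport g → tsupport g ⊆ V →
      ∫ x in V, g x * f x = 0) {x : Coord n} (hx : x ∈ V) : f x = 0 := by
  have hc : ContinuousOn f V := fun y hy => (hf y hy).continuousAt.continuousWithinAt
  have hae : ∀ᵐ y, y ∈ V → f y = 0 := by
    refine hV.ae_eq_zero_of_integral_contDiff_smul_eq_zero
      (hc.locallyIntegrableOn hV.measurableSet) fun g hg hgc hgV => ?_
    rw [← h g hg hgc hgV, ← setIntegral_univ, setIntegral_eq_of_subset_of_forall_sdiff_eq_zero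
      MeasurableSet.univ (Set.subset_univ V) fun y hy => ?_]
    · rfl
    · rw [image_eq_zero_of_notMem_tsupport fun h' => hy.2 (hgV h'), zero_smul]
  exact Measure.eqOn_open_of_ae_eq (μ := volume) (g := fun _ => 0)
    ((ae_restrict_iff' hV.measurableSet).2 hae) hV hc continuousOn_const hx

end Integration

/-! ### Locality of the operators, and the pairing computed in a single chart. -/

section Pairing

open Filter Topology

variable {n : ℕ} {M : Type*} [TopologicalSpace M] [ChartedSpace (Coord n) M]

/-- Products that vanish outside of a compact subset of the domain of a chart are integrable. -/
lemma integrableOn_mul {φ : Chart n M} {K : Set M} (hK : IsCompact K) (hKφ : K ⊆ φ.1.source)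
    {f : Coord n → ℝ} (hf : ∀ x ∈ φ.1.target, ContDiffAt ℝ ∞ f x)
    (hf0 : ∀ x ∈ φ.1.target, φ.1.symm x ∉ K → f x = 0) : IntegrableOn f φ.1.target := by
  refine integrableOn_of_compact (K := φ.1 '' K) φ.1.open_target
    (hK.image_of_continuousOn (φ.1.continuousOn.mono hKφ)) ?_ hf fun x hx hxK => ?_
  · rintro _ ⟨m, hm, rfl⟩
    exact φ.1.map_source (hKφ hm)
  · exact hf0 x hx fun h => hxK ⟨_, h, φ.1.right_inv hx⟩

lemma ActsAs.congr_zero {D : HalfDensity n M →ₗ[ℝ] HalfDensity n M} {φ : Chart n M}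
    {A : Fin n → Fin n → Coord n → ℝ} {B : Fin n → Coord n → ℝ} {C : Coord n → ℝ}
    (hD : ActsAs D φ A B C) {s : HalfDensity n M} {x : Coord n} (hx : x ∈ φ.1.target)
    (hs : s.1 φ =ᶠ[𝓝 x] fun _ => 0) : (D s).1 φ x = 0 := by
  have h1 : ∀ a, pd a (s.1 φ) =ᶠ[𝓝 x] fun _ => 0 := fun a => by
    filter_upwards [pd_eventuallyEq hs a] with y hy
    rw [hy, pd_const]
  have h2 : ∀ a b, pd b (pd a (s.1 φ)) x = 0 := fun a b => by
    rw [pd_congr (h1 a), pd_const]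
  rw [hD s x hx, hs.eq_of_nhds]
  simp [h2, (h1 _).eq_of_nhds]

/-- Differential operators are local. -/
lemma IsSecondOrder.vanishesOutside {D : HalfDensity n M →ₗ[ℝ] HalfDensity n M}
    (hD : IsSecondOrder D) {s : HalfDensity n M} {K : Set M} (hK : IsClosed K)
    (hs : VanishesOutside s K) : VanishesOutside (D s) K := by
  intro φ x hx hxK
  obtain ⟨A, B, C, -, -, -, h⟩ := hD φ
  exact h.congr_zero hx (hs.eventuallyEq hK hx hxK)

variable [IsManifold 𝓘(ℝ, Coord n) ∞ M]

lemma VanishesOutside.isCompactlySupported [T2Space M] {s : HalfDensity n M} {K : Set M}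
    (hs : VanishesOutside s K) (hK : IsCompact K) : IsCompactlySupported s := by
  refine HasCompactSupport.intro hK fun m hm => ?_
  have hm' := mem_preferredChart_source (n := n) m
  refine hs (preferredChart n m) _ ((preferredChart n m).1.map_source hm') ?_
  exact fun h => hm ((preferredChart n m).1.left_inv hm' ▸ h)

lemma IsCompactlySupported.exists_vanishesOutside {s : HalfDensity n M}
    (hs : IsCompactlySupported s) : ∃ K : Set M, IsCompact K ∧ VanishesOutside s K := by
  refine ⟨_, hs, fun φ x hx hxK => ?_⟩
  have h := image_eq_zero_of_notMem_tsupport hxK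
  have h1 := (HalfDensity.eq_zero_iff s (mem_preferredChart_source (n := n) _) (φ.1.map_target hx)).1 h
  rwa [φ.1.right_inv hx] at h1

variable [T2Space M] [SigmaCompactSpace M]

lemma chartPartition_isSubordinate :
    (chartPartition n M).IsSubordinate fun p => (preferredChart n p).1.source :=
  Classical.choose_spec
    (SmoothPartitionOfUnity.exists_isSubordinate_chartAt_source 𝓘(ℝ, Coord n) M)

lemma mem_source_of_chartPartition_ne_zero {p m : M} (h : chartPartition n M p m ≠ 0) :
    m ∈ (preferredChart n p).1.source :=
  chartPartition_isSubordinate p (subset_tsupport _ h)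

variable (n) in
-- By local finiteness, only finitely many partition functions meet `K`; this turns the `finsum` of
-- the pairing into a finite sum indexed by a set that depends on `K` alone.
lemma exists_finset_chartPartition {K : Set M} (hK : IsCompact K) :
    ∃ F : Finset M, (∀ p, p ∉ F → ∀ m ∈ K, chartPartition n M p m = 0) ∧
      ∀ m ∈ K, ∑ p ∈ F, chartPartition n M p m = 1 := by
  have hfin := (chartPartition n M).locallyFinite.finite_nonempty_inter_compact hK
  have h0 : ∀ p, p ∉ hfin.toFinset → ∀ m ∈ K, chartPartition n M p m = 0 := fun p hp m hm => by
    by_contra h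
    exact hp (hfin.mem_toFinset.2 ⟨m, h, hm⟩)
  refine ⟨hfin.toFinset, h0, fun m hm => ?_⟩
  rw [← (chartPartition n M).sum_eq_one (Set.mem_univ m)]
  refine (finsum_eq_sum_of_support_subset _ fun p hp => ?_).symm
  by_contra h
  exact hp (h0 p h m hm)

lemma pairing_comm (s t : HalfDensity n M) : pairing s t = pairing t s := by
  simp only [pairing, mul_comm]

lemma pairing_eq_sum {t : HalfDensity n M} {K : Set M} (ht : VanishesOutside t K) {F : Finset M}
    (hF : ∀ p, p ∉ F → ∀ m ∈ K, chartPartition n M p m = 0) (s : HalfDensity n M) :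
    pairing s t = ∑ p ∈ F, ∫ x in (preferredChart n p).1.target,
      chartPartition n M p ((preferredChart n p).1.symm x)
        * (s.1 (preferredChart n p) x * t.1 (preferredChart n p) x) := by
  refine finsum_eq_sum_of_support_subset _ fun p hp => ?_
  by_contra h
  refine hp (setIntegral_eq_zero_of_forall_eq_zero fun x hx => ?_)
  by_cases hxK : (chartAt (Coord n) p).symm x ∈ K
  · rw [hF p h _ hxK, zero_mul]
  · rw [ht (preferredChart n p) x hx hxK, mul_zero, mul_zero]

lemma contDiffAt_chartPartition (p : M) {φ : Chart n M} {x : Coord n} (hx : x ∈ φ.1.target) :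
    ContDiffAt ℝ ∞ (fun y => chartPartition n M p (φ.1.symm y)) x :=
  contDiffAt_comp_symm hx (chartPartition n M p).contMDiff.contMDiffAt

/-- Both `finsum` and the integral default to zero when infinite or undefined, so additivity needs
finiteness and integrability. Compact support of `t` alone provides both. -/
lemma pairing_add {t : HalfDensity n M} {K : Set M} (hK : IsCompact K) (ht : VanishesOutside t K)
    (s s' : HalfDensity n M) : pairing (s + s') t = pairing s t + pairing s' t := by
  obtain ⟨F, hF, -⟩ := exists_finset_chartPartition n hK
  rw [pairing_eq_sum ht hF, pairing_eq_sum ht hF, pairing_eq_sum ht hF, ← Finset.sum_add_distrib]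
  refine Finset.sum_congr rfl fun p _ => ?_
  have hint : ∀ u : HalfDensity n M, IntegrableOn (fun x =>
      chartPartition n M p ((preferredChart n p).1.symm x)
        * (u.1 (preferredChart n p) x * t.1 (preferredChart n p) x))
      (preferredChart n p).1.target := fun u => by
    refine integrableOn_mul (hK.inter_right (isClosed_tsupport (chartPartition n M p)))
      (fun m hm => chartPartition_isSubordinate p hm.2) (fun x hx =>
        (contDiffAt_chartPartition p hx).mul
          ((contDiffAt_halfDensity u hx).mul (contDiffAt_halfDensity t hx))) fun x hx hxK => ?_
    by_cases h : (preferredChart n p).1.symm x ∈ K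
    · rw [image_eq_zero_of_notMem_tsupport fun h' => hxK ⟨h, h'⟩, zero_mul]
    · rw [ht _ x hx h, mul_zero, mul_zero]
  rw [← integral_add (hint s) (hint s')]
  refine integral_congr_ae (ae_of_all _ fun x => ?_)
  change _ * ((s.1 _ x + s'.1 _ x) * _) = _
  ring

lemma pairing_sum {t : HalfDensity n M} {K : Set M} (hK : IsCompact K) (ht : VanishesOutside t K)
    {ι : Type*} (F : Finset ι) (s : ι → HalfDensity n M) :
    pairing (∑ i ∈ F, s i) t = ∑ i ∈ F, pairing (s i) t := by
  classical
  induction F using Finset.induction_on with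
  | empty =>
    obtain ⟨F, hF, -⟩ := exists_finset_chartPartition n hK
    rw [Finset.sum_empty, Finset.sum_empty, pairing_eq_sum ht hF]
    refine Finset.sum_eq_zero fun p _ => ?_
    refine setIntegral_eq_zero_of_forall_eq_zero fun x _ => ?_
    change _ * ((0 : ℝ) * _) = 0
    rw [zero_mul, mul_zero]
  | insert i F hi ih => rw [Finset.sum_insert hi, Finset.sum_insert hi, pairing_add hK ht, ih]

/-- The pairing with a half-density supported in the domain of a chart, as an integral. -/
lemma pairing_eq_setIntegral {φ : Chart n M} {t : HalfDensity n M} {K : Set M} (hK : IsCompact K)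
    (hKφ : K ⊆ φ.1.source) (ht : VanishesOutside t K) (s : HalfDensity n M) :
    pairing s t = ∫ x in φ.1.target, s.1 φ x * t.1 φ x := by
  obtain ⟨F, hF, hF1⟩ := exists_finset_chartPartition n hK
  -- Change of variables: the two factors `√|J|` of the half-densities multiply to the `|J|` of the
  -- integral. Outside the overlap the integrand vanishes, by the support of `t` in one chart and by
  -- that of the partition function in the other.
  have hterm : ∀ p, ∫ x in (preferredChart n p).1.target,
      chartPartition n M p ((preferredChart n p).1.symm x)
        * (s.1 (preferredChart n p) x * t.1 (preferredChart n p) x) =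
      ∫ x in φ.1.target, chartPartition n M p (φ.1.symm x) * (s.1 φ x * t.1 φ x) := fun p => by
    set π := preferredChart n p
    have h1 : overlap π φ ⊆ π.1.target := fun x hx => (mem_overlap.1 hx).1
    have h2 : overlap φ π ⊆ φ.1.target := fun x hx => (mem_overlap.1 hx).1
    rw [setIntegral_eq_of_subset_of_forall_sdiff_eq_zero π.1.open_target.measurableSet h1
      fun x hx => ?_, setIntegral_eq_of_subset_of_forall_sdiff_eq_zero φ.1.open_target.measurableSet
      h2 fun x hx => ?_, ← image_transition φ π, integral_image_eq_integral_abs_det_fderiv_smul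
      volume (isOpen_overlap φ π).measurableSet (fun x hx =>
        (contDiffAt_transition hx).differentiableAt_infty.hasFDerivAt.hasFDerivWithinAt)
      (injOn_transition φ π)]
    · refine setIntegral_congr_fun (isOpen_overlap φ π).measurableSet fun x hx => ?_
      change |jacobian φ π x| • _ = _
      simp only [symm_transition hx, s.2.2 φ π x hx, t.2.2 φ π x hx, smul_eq_mul]
      have hsq := Real.mul_self_sqrt (abs_nonneg (jacobian φ π x))
      linear_combination (-(chartPartition n M p (φ.1.symm x) * s.1 π (transition φ π x)
        * t.1 π (transition φ π x))) * hsq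
    · by_contra h
      exact hx.2 (mem_overlap.2 ⟨hx.1, mem_source_of_chartPartition_ne_zero (left_ne_zero_of_mul h)⟩)
    · rw [ht π x hx.1 fun h => hx.2 (mem_overlap.2 ⟨hx.1, hKφ h⟩), mul_zero, mul_zero]
  rw [pairing_eq_sum ht hF, Finset.sum_congr rfl fun p _ => hterm p, ← integral_finsetSum]
  · refine setIntegral_congr_fun φ.1.open_target.measurableSet fun x hx => ?_
    simp only [← Finset.sum_mul]
    by_cases hxK : φ.1.symm x ∈ K
    · rw [hF1 _ hxK, one_mul]
    · rw [ht φ x hx hxK, mul_zero, mul_zero]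
  · refine fun p _ => integrableOn_mul hK hKφ (fun x hx => (contDiffAt_chartPartition p hx).mul
      ((contDiffAt_halfDensity s hx).mul (contDiffAt_halfDensity t hx))) fun x hx hxK => ?_
    rw [ht φ x hx hxK, mul_zero, mul_zero]

end Pairing

/-! ### Self-adjointness and the first order coefficients. -/

section SelfAdjoint

open Filter Topology

variable {n : ℕ} {M : Type*} [TopologicalSpace M] [ChartedSpace (Coord n) M]

/-- Green's identity: symmetry of `S` cancels the products of first derivatives of `u` and `v`. -/
lemma mul_divForm_sub {S : Fin n → Fin n → Coord n → ℝ} {u v : Coord n → ℝ} {x : Coord n}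
    (hS : ∀ a b, ContDiffAt ℝ ∞ (S a b) x) (hsymm : ∀ a b, S a b x = S b a x)
    (hu : ContDiffAt ℝ ∞ u x) (hv : ContDiffAt ℝ ∞ v x) :
    v x * divForm S u x - u x * divForm S v x =
      ∑ a, pd a (fun y => v y * (∑ b, S a b y * pd b u y) - u y * ∑ b, S a b y * pd b v y) x := by
  have h : ∀ a, pd a (fun y => v y * (∑ b, S a b y * pd b u y)
      - u y * ∑ b, S a b y * pd b v y) x =
      (pd a v x * (∑ b, S a b x * pd b u x) + v x * pd a (fun y => ∑ b, S a b y * pd b u y) x)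
      - (pd a u x * (∑ b, S a b x * pd b v x)
        + u x * pd a (fun y => ∑ b, S a b y * pd b v y) x) := fun a => by
    have h1 := (contDiffAt_flux hS hu a).differentiableAt_infty
    have h2 := (contDiffAt_flux hS hv a).differentiableAt_infty
    have h3 : DifferentiableAt ℝ (fun y => v y * (∑ b, S a b y * pd b u y)) x :=
      hv.differentiableAt_infty.mul h1
    have h4 : DifferentiableAt ℝ (fun y => u y * (∑ b, S a b y * pd b v y)) x :=
      hu.differentiableAt_infty.mul h2
    rw [pd_sub a h3 h4, pd_mul a hv.differentiableAt_infty h1, pd_mul a hu.differentiableAt_infty h2]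
  have hsum : ∑ a, pd a v x * (∑ b, S a b x * pd b u x) =
      ∑ a, pd a u x * (∑ b, S a b x * pd b v x) := by
    simp only [Finset.mul_sum]
    rw [Finset.sum_comm]
    refine Finset.sum_congr rfl fun a _ => Finset.sum_congr rfl fun b _ => ?_
    rw [hsymm a b]; ring
  simp only [h, Finset.sum_sub_distrib, Finset.sum_add_distrib, hsum, divForm, ← Finset.mul_sum]
  ring

/-- The commutator of a second order operator with the multiplication by a coordinate. -/
lemma ActsAs.apply_coord_mul {D : HalfDensity n M →ₗ[ℝ] HalfDensity n M} {S : SymTensor n M}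
    {φ : Chart n M} {B : Fin n → Coord n → ℝ} {C : Coord n → ℝ}
    (hD : ActsAs D φ (fun a b x => (1 / 2) * S.comp φ a b x) B C) {s s' : HalfDensity n M}
    {c : Fin n} {r : ℝ} (hs : ∀ y ∈ φ.1.target, s'.1 φ y = (y c - r) * s.1 φ y)
    {x : Coord n} (hx : x ∈ φ.1.target) :
    (D s').1 φ x = (x c - r) * (D s).1 φ x
      + (∑ b, S.comp φ c b x * pd b (s.1 φ) x + B c x * s.1 φ x) := by
  have hse : s'.1 φ =ᶠ[𝓝 x] fun y => (y c - r) * s.1 φ y := by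
    filter_upwards [φ.1.open_target.mem_nhds hx] with y hy using hs y hy
  have hc : ContDiffAt ℝ ∞ (fun y : Coord n => y c - r) x := (contDiff_coord_sub c r).contDiffAt
  have hu := contDiffAt_halfDensity s hx
  have h1 : ∀ a, pd a (s'.1 φ) x =
      (x c - r) * pd a (s.1 φ) x + (if a = c then s.1 φ x else 0) := fun a => by
    rw [pd_congr hse, pd_mul a hc.differentiableAt_infty hu.differentiableAt_infty, pd_coord]
    split_ifs <;> ring
  have h2 : ∀ a b, pd b (pd a (s'.1 φ)) x = (x c - r) * pd b (pd a (s.1 φ)) x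
      + ((if a = c then pd b (s.1 φ) x else 0) + (if b = c then pd a (s.1 φ) x else 0)) :=
    fun a b => by
      have h3 : pd b (pd a fun y : Coord n => y c - r) x = 0 := by
        have : (pd a fun y : Coord n => y c - r) = fun _ => if a = c then 1 else 0 :=
          funext fun y => pd_coord a c r
        rw [this, pd_const]
      rw [pd_congr (pd_eventuallyEq hse a), pd_pd_mul a b hc hu, h3, pd_coord, pd_coord]
      split_ifs <;> ring
  have hA : ∑ a, ∑ b, (1 / 2) * S.comp φ a b x *
      ((if a = c then pd b (s.1 φ) x else 0) + (if b = c then pd a (s.1 φ) x else 0)) =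
      ∑ b, S.comp φ c b x * pd b (s.1 φ) x := by
    simp only [mul_add, Finset.sum_add_distrib, mul_ite, mul_zero, Finset.sum_ite_eq',
      Finset.mem_univ, if_true]
    rw [Finset.sum_comm]
    simp only [Finset.sum_ite_eq', Finset.mem_univ, if_true, ← Finset.sum_add_distrib]
    refine Finset.sum_congr rfl fun b _ => ?_
    rw [S.symmetric φ b c]
    ring
  have hB : ∑ a, B a x * (if a = c then s.1 φ x else 0) = B c x * s.1 φ x := by simp
  rw [hD s' x hx, hD s x hx, hs x hx, ← hA, ← hB]
  simp only [h1, h2, mul_add, Finset.sum_add_distrib, Finset.mul_sum]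
  have e1 : ∀ a b, (1 / 2) * S.comp φ a b x * ((x c - r) * pd b (pd a (s.1 φ)) x) =
      (x c - r) * ((1 / 2) * S.comp φ a b x * pd b (pd a (s.1 φ)) x) := fun a b => by ring
  have e2 : ∀ a, B a x * ((x c - r) * pd a (s.1 φ) x) =
      (x c - r) * (B a x * pd a (s.1 φ) x) := fun a => by ring
  simp only [e1, e2]
  ring

lemma integrableOn_halfDensity_mul {φ : Chart n M} {s : HalfDensity n M} {K : Set M}
    (hK : IsCompact K) (hKφ : K ⊆ φ.1.source) (hs : VanishesOutside s K) (t : HalfDensity n M) :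
    IntegrableOn (fun x => s.1 φ x * t.1 φ x) φ.1.target :=
  integrableOn_mul hK hKφ
    (fun _ hx => (contDiffAt_halfDensity s hx).mul (contDiffAt_halfDensity t hx))
    fun x hx hxK => by rw [hs φ x hx hxK, zero_mul]

variable [IsManifold 𝓘(ℝ, Coord n) ∞ M] [T2Space M] [SigmaCompactSpace M]

lemma pairing_eq_setIntegral_left {φ : Chart n M} {s : HalfDensity n M} {K : Set M}
    (hK : IsCompact K) (hKφ : K ⊆ φ.1.source) (hs : VanishesOutside s K) (t : HalfDensity n M) :
    pairing s t = ∫ x in φ.1.target, s.1 φ x * t.1 φ x := by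
  rw [pairing_comm, pairing_eq_setIntegral hK hKφ hs]
  simp only [mul_comm]

/-- The terms with `U` cancel, and Green's identity leaves the divergence of a field that vanishes
outside `K`, whose integral is zero. It suffices that `s` is supported in the chart. -/
lemma HasLocalForm.pairing_eq_of_chart {D : HalfDensity n M →ₗ[ℝ] HalfDensity n M}
    {S : SymTensor n M} {U : ChartFunctions n M} (hD : HasLocalForm D S U) {φ : Chart n M}
    {K : Set M} (hK : IsCompact K) (hKφ : K ⊆ φ.1.source) {s : HalfDensity n M}
    (hs : VanishesOutside s K) (t : HalfDensity n M) : pairing (D s) t = pairing s (D t) := by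
  have hDs := hD.hasPrincipalSymbol.isSecondOrder.vanishesOutside hK.isClosed hs
  rw [pairing_eq_setIntegral_left hK hKφ hDs, pairing_eq_setIntegral_left hK hKφ hs, ← sub_eq_zero,
    ← integral_sub (integrableOn_halfDensity_mul hK hKφ hDs t)
      (integrableOn_halfDensity_mul hK hKφ hs (D t))]
  have hpt : ∀ x ∈ φ.1.target, (D s).1 φ x * t.1 φ x - s.1 φ x * (D t).1 φ x =
      (1 / 2) * ∑ a, pd a (fun y => t.1 φ y * (∑ b, S.comp φ a b y * pd b (s.1 φ) y)
        - s.1 φ y * ∑ b, S.comp φ a b y * pd b (t.1 φ) y) x := fun x hx => by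
    rw [← mul_divForm_sub (fun a b => S.contDiffAt hx a b)
      (fun a b => congrFun (S.symmetric φ a b) x) (contDiffAt_halfDensity s hx)
      (contDiffAt_halfDensity t hx), hasLocalForm_iff.1 hD φ s x hx, hasLocalForm_iff.1 hD φ t x hx]
    ring
  rw [setIntegral_congr_fun φ.1.open_target.measurableSet hpt, integral_const_mul,
    setIntegral_sum_pd_eq_zero (K := φ.1 '' K) φ.1.open_target
      (hK.image_of_continuousOn (φ.1.continuousOn.mono hKφ)), mul_zero]
  · rintro _ ⟨m, hm, rfl⟩
    exact φ.1.map_source (hKφ hm)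
  · exact fun a x hx => ((contDiffAt_halfDensity t hx).mul
      (contDiffAt_flux (fun a b => S.contDiffAt hx a b) (contDiffAt_halfDensity s hx) a)).sub
      ((contDiffAt_halfDensity s hx).mul
      (contDiffAt_flux (fun a b => S.contDiffAt hx a b) (contDiffAt_halfDensity t hx) a))
  · intro a x hx hxK
    have h0 := hs.eventuallyEq hK.isClosed hx fun h => hxK ⟨_, h, φ.1.right_inv hx⟩
    have h1 : ∀ b, pd b (s.1 φ) x = 0 := fun b => by rw [pd_congr h0, pd_const]
    simp [h1, h0.eq_of_nhds]

/-- Operators in divergence form are self-adjoint. -/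
lemma HasLocalForm.isSelfAdjointOperator {D : HalfDensity n M →ₗ[ℝ] HalfDensity n M}
    {S : SymTensor n M} {U : ChartFunctions n M} (hD : HasLocalForm D S U) :
    IsSelfAdjointOperator D := by
  intro s t hs ht
  obtain ⟨K, hK, hsK⟩ := hs.exists_vanishesOutside
  obtain ⟨L, hL, htL⟩ := ht.exists_vanishesOutside
  have hDt := hD.hasPrincipalSymbol.isSecondOrder.vanishesOutside hL.isClosed htL
  obtain ⟨F, -, hF⟩ := exists_finset_chartPartition n hK
  -- Cutting `s` alone into pieces supported in charts is enough; `t` and, by locality, `D t` keep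
  -- their compact support `L`.
  have hsum : s = ∑ p ∈ F,
      mulFun (chartPartition n M p) (chartPartition n M p).contMDiff s := by
    refine HalfDensity.ext fun φ x hx => ?_
    rw [AddSubmonoidClass.coe_finsetSum, Finset.sum_apply, Finset.sum_apply]
    simp only [mulFun_apply _ s hx, ← Finset.sum_mul]
    by_cases hxK : φ.1.symm x ∈ K
    · rw [hF _ hxK, one_mul]
    · rw [hsK φ x hx hxK, mul_zero]
  rw [hsum, map_sum, pairing_sum hL htL, pairing_sum hL hDt]
  refine Finset.sum_congr rfl fun p _ => ?_
  refine hD.pairing_eq_of_chart (φ := preferredChart n p)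
    (hK.inter_right (isClosed_tsupport (chartPartition n M p)))
    (fun m hm => chartPartition_isSubordinate p hm.2) (fun φ x hx hxK => ?_) t
  rw [mulFun_apply _ s hx]
  by_cases h : φ.1.symm x ∈ K
  · rw [image_eq_zero_of_notMem_tsupport fun h' => hxK ⟨h, h'⟩, zero_mul]
  · rw [hsK φ x hx h, mul_zero]

/-- The first order coefficients of a self-adjoint operator. -/
lemma IsSelfAdjointOperator.coeff_eq {D : HalfDensity n M →ₗ[ℝ] HalfDensity n M}
    (hD : IsSelfAdjointOperator D) (hD2 : IsSecondOrder D) {S : SymTensor n M} {φ : Chart n M}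
    {B : Fin n → Coord n → ℝ} {C : Coord n → ℝ} (hB : ∀ a, IsLocalFunction φ (B a))
    (hact : ActsAs D φ (fun a b x => (1 / 2) * S.comp φ a b x) B C) (c : Fin n) {x : Coord n}
    (hx : x ∈ φ.1.target) : B c x = (1 / 2) * ∑ b, pd b (S.comp φ b c) x := by
  obtain ⟨f, hf, hfc, hfs, hf1⟩ := exists_bump hx
  have hE : ∀ y ∈ φ.1.target, ContDiffAt ℝ ∞ (fun y => 2 * B c y - ∑ b, pd b (S.comp φ c b) y) y :=
    fun y hy => (contDiffAt_const.mul ((hB c).contDiffAt hy)).sub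
      (ContDiffAt.sum fun b _ => (S.contDiffAt hy c b).pd b)
  -- The bump `f`, equal to `1` near `x`, will be the coefficient of a compactly supported `s`,
  -- while an arbitrary test function `g` will be that of `t`.
  suffices h : (2 * B c x - ∑ b, pd b (S.comp φ c b) x) * f x = 0 by
    rw [hf1.eq_of_nhds, mul_one] at h
    simp only [S.symmetric φ _ c]
    linarith
  refine eq_zero_of_integral_mul_eq_zero φ.1.open_target
    (f := fun y => (2 * B c y - ∑ b, pd b (S.comp φ c b) y) * f y)
    (fun y hy => (hE y hy).mul hf.contDiffAt) (fun g hg hgc hgs => ?_) hx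
  have hcompact : ∀ {k : Coord n → ℝ}, HasCompactSupport k → tsupport k ⊆ φ.1.target →
      IsCompact (φ.1.symm '' tsupport k) ∧ φ.1.symm '' tsupport k ⊆ φ.1.source :=
    fun {k} hk hks => ⟨hk.image_of_continuousOn (φ.1.continuousOn_symm.mono hks), by
      rintro _ ⟨y, hy, rfl⟩
      exact φ.1.map_target (hks hy)⟩
  have hmul : ∀ {k : Coord n → ℝ}, ContDiff ℝ ∞ k → HasCompactSupport k →
      tsupport k ⊆ φ.1.target → ∃ s : HalfDensity n M,
        (∀ y ∈ φ.1.target, s.1 φ y = (y c - x c) * k y) ∧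
        VanishesOutside s (φ.1.symm '' tsupport k) := fun {k} hk hkc hks => by
    have hsub := tsupport_mul_subset_right (f := fun y : Coord n => y c - x c) (g := k)
    obtain ⟨s, hs, hs'⟩ := exists_halfDensity_eq (φ := φ)
      (f := fun y : Coord n => (y c - x c) * k y) ((contDiff_coord_sub c (x c)).mul hk)
      hkc.mul_left (hsub.trans hks)
    exact ⟨s, hs, fun ψ y hy hyK => hs' ψ y hy fun h => hyK (Set.image_mono hsub h)⟩
  obtain ⟨hKf, hKfφ⟩ := hcompact hfc hfs
  obtain ⟨hKg, hKgφ⟩ := hcompact hgc hgs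
  obtain ⟨s, hs, hsK⟩ := exists_halfDensity_eq hf hfc hfs
  obtain ⟨t, ht, htK⟩ := exists_halfDensity_eq hg hgc hgs
  obtain ⟨s', hs', hsK'⟩ := hmul hf hfc hfs
  obtain ⟨t', ht', htK'⟩ := hmul hg hgc hgs
  -- Self-adjointness rewritten as an integral over the chart, to be used for the pairs `(s', t)`
  -- and `(s, t')`, where the prime is multiplication by `x^c` minus a constant.
  have hpair : ∀ {u v : HalfDensity n M}, VanishesOutside u (φ.1.symm '' tsupport f) →
      VanishesOutside v (φ.1.symm '' tsupport g) →
      IntegrableOn (fun y => (D u).1 φ y * v.1 φ y - u.1 φ y * (D v).1 φ y) φ.1.target ∧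
      ∫ y in φ.1.target, ((D u).1 φ y * v.1 φ y - u.1 φ y * (D v).1 φ y) = 0 :=
    fun {u v} hu hv => by
      have hDu := hD2.vanishesOutside hKf.isClosed hu
      have h1 := integrableOn_halfDensity_mul hKf hKfφ hDu v
      have h2 := integrableOn_halfDensity_mul hKf hKfφ hu (D v)
      refine ⟨h1.sub h2, ?_⟩
      rw [integral_sub h1 h2, ← pairing_eq_setIntegral_left hKf hKfφ hDu,
        ← pairing_eq_setIntegral_left hKf hKfφ hu,
        hD u v (hu.isCompactlySupported hKf) (hv.isCompactlySupported hKg), sub_self]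
  obtain ⟨hi1, hI1⟩ := hpair hsK' htK
  obtain ⟨hi2, hI2⟩ := hpair hsK htK'
  have hX : ∀ b, ∀ y ∈ φ.1.target,
      ContDiffAt ℝ ∞ (fun y => S.comp φ c b y * (f y * g y)) y := fun b y hy =>
    (S.contDiffAt hy c b).mul (hf.contDiffAt.mul hg.contDiffAt)
  have hX0 : ∀ b, ∀ y ∈ φ.1.target, y ∉ tsupport f → S.comp φ c b y * (f y * g y) = 0 :=
    fun b y _ hyf => by rw [image_eq_zero_of_notMem_tsupport hyf, zero_mul, mul_zero]
  have hI3 := setIntegral_sum_pd_eq_zero φ.1.open_target hfc hfs hX hX0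
  have hi3 : IntegrableOn (fun y => ∑ b, pd b (fun y => S.comp φ c b y * (f y * g y)) y)
      φ.1.target := by
    refine integrableOn_of_compact φ.1.open_target hfc hfs
      (fun y hy => ContDiffAt.sum fun b _ => (hX b y hy).pd b) fun y hy hyf => ?_
    refine Finset.sum_eq_zero fun b _ => ?_
    have h : (fun y => S.comp φ c b y * (f y * g y)) =ᶠ[𝓝 y] fun _ => 0 := by
      filter_upwards [φ.1.open_target.mem_nhds hy,
        (isClosed_tsupport f).isOpen_compl.mem_nhds hyf] with z hz hz' using hX0 b z hz hz'
    rw [pd_congr h, pd_const]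
  -- With `P = S^{cb} ∂_b + B^c` the commutator of `D` and `x^c`, the first two differences combine
  -- to `(P f) g + f (P g) = S^{cb} ∂_b (f g) + 2 B^c f g`. Subtracting the divergence `∂_b (S^{cb}
  -- f g)` leaves the defect `2 B^c - ∂_b S^{cb}` times `f g`.
  have hpt : ∀ y ∈ φ.1.target, g y * ((2 * B c y - ∑ b, pd b (S.comp φ c b) y) * f y) =
      ((D s').1 φ y * t.1 φ y - s'.1 φ y * (D t).1 φ y)
      - ((D s).1 φ y * t'.1 φ y - s.1 φ y * (D t').1 φ y)
      - ∑ b, pd b (fun y => S.comp φ c b y * (f y * g y)) y := fun y hy => by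
    have hse : s.1 φ =ᶠ[𝓝 y] f := by
      filter_upwards [φ.1.open_target.mem_nhds hy] with z hz using hs z hz
    have hte : t.1 φ =ᶠ[𝓝 y] g := by
      filter_upwards [φ.1.open_target.mem_nhds hy] with z hz using ht z hz
    have h1 := hact.apply_coord_mul (s := s) (s' := s') (c := c) (r := x c)
      (fun z hz => by rw [hs' z hz, hs z hz]) hy
    have h2 := hact.apply_coord_mul (s := t) (s' := t') (c := c) (r := x c)
      (fun z hz => by rw [ht' z hz, ht z hz]) hy
    have h3 : ∀ b, pd b (fun y => S.comp φ c b y * (f y * g y)) y =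
        pd b (S.comp φ c b) y * (f y * g y) + (g y * (S.comp φ c b y * pd b f y)
          + f y * (S.comp φ c b y * pd b g y)) := fun b => by
      have hfd := hf.contDiffAt (x := y) |>.differentiableAt_infty
      have hgd := hg.contDiffAt (x := y) |>.differentiableAt_infty
      have hfg : DifferentiableAt ℝ (fun y => f y * g y) y := hfd.mul hgd
      rw [pd_mul b (S.contDiffAt hy c b).differentiableAt_infty hfg, pd_mul b hfd hgd]
      ring
    simp only [pd_congr hse, pd_congr hte] at h1 h2
    rw [h1, h2, hs' y hy, ht' y hy, hs y hy, ht y hy]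
    simp only [h3, Finset.sum_add_distrib, ← Finset.mul_sum, ← Finset.sum_mul]
    ring
  have hi12 : IntegrableOn (fun y => ((D s').1 φ y * t.1 φ y - s'.1 φ y * (D t).1 φ y)
      - ((D s).1 φ y * t'.1 φ y - s.1 φ y * (D t').1 φ y)) φ.1.target := hi1.sub hi2
  rw [setIntegral_congr_fun φ.1.open_target.measurableSet hpt, integral_sub hi12 hi3,
    integral_sub hi1 hi2, hI1, hI2, hI3]
  ring

lemma IsSelfAdjointOperator.exists_hasLocalForm {D : HalfDensity n M →ₗ[ℝ] HalfDensity n M}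
    (hD : IsSelfAdjointOperator D) {S : SymTensor n M} (hS : HasPrincipalSymbol D S) :
    ∃ U : ChartFunctions n M, HasLocalForm D S U := by
  have hD2 := hS.isSecondOrder
  choose B C hB hC hact using hS
  -- Self-adjointness leaves the zeroth order coefficient free; the factor `2` compensates the
  -- overall `1/2`.
  refine ⟨⟨fun φ x => 2 * C φ x, fun φ => ⟨contDiffOn_const.mul (hC φ).1,
    fun x hx => by simp only [(hC φ).2 x hx, mul_zero]⟩⟩, fun φ s x hx => ?_⟩
  rw [hact φ s x hx]
  congr 1
  · congr 1
    exact Finset.sum_congr rfl fun a _ => by rw [hD.coeff_eq hD2 (hB φ) (hact φ) a hx]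
  · ring

end SelfAdjoint

end HalfDensities

theorem mainTheorem4 {n : ℕ} {M : Type*} [TopologicalSpace M]
    [ChartedSpace (HalfDensities.Coord n) M]
    [IsManifold 𝓘(ℝ, HalfDensities.Coord n) ∞ M] [T2Space M] [SigmaCompactSpace M] :
    -- A self-adjoint second order operator has a unique principal symbol.
    (∀ D : HalfDensities.HalfDensity n M →ₗ[ℝ] HalfDensities.HalfDensity n M,
      HalfDensities.IsSecondOrder D → HalfDensities.IsSelfAdjointOperator D →
        ∃! S : HalfDensities.SymTensor n M, HalfDensities.HasPrincipalSymbol D S) ∧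
    -- Given its principal symbol, it has a unique potential, and this is a compensating field.
    (∀ (D : HalfDensities.HalfDensity n M →ₗ[ℝ] HalfDensities.HalfDensity n M)
      (S : HalfDensities.SymTensor n M),
      HalfDensities.IsSecondOrder D → HalfDensities.IsSelfAdjointOperator D →
      HalfDensities.HasPrincipalSymbol D S →
        (∃! U : HalfDensities.ChartFunctions n M, HalfDensities.HasLocalForm D S U) ∧
        ∀ U : HalfDensities.ChartFunctions n M, HalfDensities.HasLocalForm D S U →
          HalfDensities.IsCompensatingField S U) ∧
    -- Every tensor field and every compensating field for it define exactly one operator, and this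
    -- operator is of second order and self-adjoint, with the given principal symbol.
    (∀ (S : HalfDensities.SymTensor n M) (U : HalfDensities.ChartFunctions n M),
      HalfDensities.IsCompensatingField S U →
        (∃! D : HalfDensities.HalfDensity n M →ₗ[ℝ] HalfDensities.HalfDensity n M,
          HalfDensities.HasLocalForm D S U) ∧
        ∀ D : HalfDensities.HalfDensity n M →ₗ[ℝ] HalfDensities.HalfDensity n M,
          HalfDensities.HasLocalForm D S U →
            HalfDensities.IsSecondOrder D ∧ HalfDensities.IsSelfAdjointOperator D ∧
              HalfDensities.HasPrincipalSymbol D S) ∧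
    -- For a given tensor field, the compensating fields form an affine space (in particular, a
    -- nonempty one) over the smooth functions on `M`, which act by addition.
    (∀ S : HalfDensities.SymTensor n M,
      ∃ _ : AddTorsor C^∞⟮𝓘(ℝ, HalfDensities.Coord n), M; 𝓘(ℝ, ℝ), ℝ⟯
          (HalfDensities.CompensatingField S),
        ∀ (F : C^∞⟮𝓘(ℝ, HalfDensities.Coord n), M; 𝓘(ℝ, ℝ), ℝ⟯)
          (U : HalfDensities.CompensatingField S) (φ : HalfDensities.Chart n M),
          ∀ x ∈ φ.1.target, (F +ᵥ U).1.1 φ x = U.1.1 φ x + F (φ.1.symm x)) := by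
  refine ⟨fun D hD _ => ?_, fun D S _ hsa hS => ⟨?_, fun U hU => hU.isCompensatingField⟩,
    fun S U hU => ⟨?_, fun D hD => ?_⟩, fun S => ?_⟩
  · obtain ⟨S, hS⟩ := hD.exists_hasPrincipalSymbol
    exact ⟨S, hS, fun S' hS' => hS'.unique hS⟩
  · obtain ⟨U, hU⟩ := hsa.exists_hasLocalForm hS
    exact ⟨U, hU, fun U' hU' => hU'.potential_unique hU⟩
  · have h := HalfDensities.operatorOf_hasLocalForm S U hU
    exact ⟨_, h, fun D' hD' => hD'.operator_unique h⟩
  · exact ⟨hD.hasPrincipalSymbol.isSecondOrder, hD.isSelfAdjointOperator, hD.hasPrincipalSymbol⟩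
  · exact ⟨HalfDensities.compensatingTorsor S, fun F U φ x hx =>
      HalfDensities.CompensatingField.add_apply F U hx⟩
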